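/- Throughout, $k$ is a commutative ring, all algebras are unital associative $k$-algebras, all modules are $k$-modules and all maps are $k$-linear. **Hopf algebroids.** A *left bialgebroid* $\mathcal H_L=(H,L,s_L,t_L,\gamma_L,\pi_L)$ consists of algebras $L$ and $H$, an algebra map $s_L:L\to H$ and an anti-algebra map $t_L:L\to H$ with commuting images, and an $L$-coring structure, with coproduct $\gamma_L(h)=h_{(1)}\otimes_L h_{(2)}$ and counit $\pi_L$, on the bimodule $H$ with $l\cdot h\cdot l'=s_L(l)t_L(l')h$, such that $h_{(1)}t_L(l)\otimes_L h_{(2)}=h_{(1)}\otimes_L h_{(2)}s_L(l)$, $\gamma_L$ is unital and multiplicative, $\pi_L(1)=1$ and $\pi_L(h\,s_L(\pi_L(h')))=\pi_L(hh')=\pi_L(h\,t_L(\pi_L(h')))$. A *right bialgebroid* $\mathcal H_R=(H,R,s_R,t_R,\gamma_R,\pi_R)$, with $\gamma_R(h)=h^{(1)}\otimes_R h^{(2)}$, is defined symmetrically, using the bimodule structure $r\cdot h\cdot r'=h\,s_R(r')t_R(r)$. A *Hopf algebroid* $\mathcal H=(\mathcal H_L,\mathcal H_R,S)$ consists of a left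 and a right bialgebroid on the same algebra $H$ and a $k$-linear map $S:H\to H$ (the antipode, not assumed to be bijective) such that - $s_L\pi_Lt_R=t_R$, $t_L\pi_Ls_R=s_R$, $s_R\pi_Rt_L=t_L$, $t_R\pi_Rs_L=s_L$; - $\gamma_L$ is $R$-bilinear and $\gamma_R$ is $L$-bilinear (with respect to the actions $r\cdot h\cdot r'$ and $l\cdot h\cdot l'$ above, the left actions being on the first and the right actions on the second tensor factor), $(\gamma_L\otimes_R H)\gamma_R=(H\otimes_L\gamma_R)\gamma_L$ and $(\gamma_R\otimes_L H)\gamma_L=(H\otimes_R\gamma_L)\gamma_R$; - $S(t_L(l)\,h\,t_R(r))=s_R(r)S(h)s_L(l)$; - $S(h_{(1)})h_{(2)}=s_R(\pi_R(h))$ and $h^{(1)}S(h^{(2)})=s_L(\pi_L(h))$. No purity condition is imposed. **Comodules.** A (right) $\mathcal H$-*comodule* is a right $R$- and right $L$-module $M$ with a coaction $m\mapsto m^{[0]}\otimes_R m^{[1]}$ of the $R$-coring $\mathcal H_R$ and a coaction $m\mapsto m_{[0]}\otimes_L m_{[1]}$ of the $L$-coring $\mathcal H_L$, such that the $\mathcal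 H_R$-coaction is an $\mathcal H_L$-comodule map and the $\mathcal H_L$-coaction is an $\mathcal H_R$-comodule map. A morphism of $\mathcal H$-comodules is a right $R$- and right $L$-linear map commuting with both coactions. $\mathcal H$-comodules form a monoidal category $\mathcal M^{\mathcal H}$: the tensor product is $\otimes_R$, the left $R$-action on a comodule being $r\,m=m\,\pi_L(s_R(r))$, with the diagonal coactions $m\otimes n\mapsto (m^{[0]}\otimes_R n^{[0]})\otimes_R m^{[1]}n^{[1]}$ and $m\otimes n\mapsto (m_{[0]}\otimes_R n_{[0]})\otimes_L m_{[1]}n_{[1]}$. An $\mathcal H$-*comodule algebra* $A$ is a monoid in $\mathcal M^{\mathcal H}$; in particular it is an $R$-ring with unit map $\eta_R:R\to A$. Let $\mathcal M^{\mathcal H}_A$ be the category of right $A$-modules in $\mathcal M^{\mathcal H}$. The algebra $H$, with coactions $\gamma_R$ and $\gamma_L$, is an $\mathcal H$-comodule algebra. The *coinvariants* of $A$ form the subalgebra $T=\{a\in A\mid a^{[0]}\otimes_R a^{[1]}=a\otimes_R 1_H\}$. **Cleft extensions.** $T\subseteq A$ is $\mathcal H$-*cleft* if there are an algebra map $\eta_L:L\to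 A$ with image in $T$ (so that $A$ is an $L$-ring and $T$ an $L$-subring), a left $L$-linear morphism of $\mathcal H$-comodules $j:H\to A$ (that is, $j(s_L(l)h)=\eta_L(l)j(h)$), and a map $\widetilde j:H\to A$ with $\widetilde j(h\,t_R(r))=\eta_R(r)\widetilde j(h)$ and $\widetilde j(t_L(l)h)=\widetilde j(h)\eta_L(l)$, such that for all $h\in H$ $$j(h^{(1)})\,\widetilde j(h^{(2)})=\eta_L(\pi_L(h)),\qquad \widetilde j(h_{(1)})\,j(h_{(2)})=\eta_R(\pi_R(h)).$$ **Theorem.** Let $\mathcal H$ be any (not necessarily pure) Hopf algebroid. 1. For every $\mathcal H$-comodule algebra $A$ such that $T\subseteq A$ is $\mathcal H$-cleft, where $T$ is the subalgebra of coinvariants, the functor $-\otimes_T A:\mathcal M_T\to\mathcal M^{\mathcal H}_A$ (with the $A$-action and the $\mathcal H$-coactions on the second factor) is an equivalence of categories. 2. The functor $-\otimes_L H:\mathcal M_L\to\mathcal M^{\mathcal H}_H$, where $H$ is a left $L$-module via $s_L$, is an equivalence of categories. -/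

import Mathlib

open TensorProduct MulOpposite CategoryTheory

universe v u₁ u₂ u₃ u₄ u₅

namespace HopfAlgd

/-! ### Modules over noncommutative algebras and balanced tensor products

All modules carry a fixed `k`-module structure. A `k`-module may carry several actions of the same
algebra, so that actions are explicit homomorphisms to the endomorphism algebra. -/

/-- A left module structure of the `k`-algebra `B` on the `k`-module `M`. -/
abbrev LAct (k B M : Type*) [CommRing k] [Ring B] [Algebra k B] [AddCommGroup M] [Module k M] :=
  B →ₐ[k] Module.End k M

/-- A right module structure of the `k`-algebra `B` on the `k`-module `M`. -/
abbrev RAct (k B M : Type*) [CommRing k] [Ring B] [Algebra k B] [AddCommGroup M] [Module k M] :=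
  Bᵐᵒᵖ →ₐ[k] Module.End k M

section BT

variable {k : Type*} [CommRing k] {B : Type*} [Ring B] [Algebra k B]
  {C : Type*} [Ring C] [Algebra k C]
  {M : Type*} [AddCommGroup M] [Module k M] {N : Type*} [AddCommGroup N] [Module k N]
  {M' : Type*} [AddCommGroup M'] [Module k M'] {N' : Type*} [AddCommGroup N'] [Module k N']
  {P : Type*} [AddCommGroup P] [Module k P]
  {X : Type*} [AddCommGroup X] [Module k X] {Y : Type*} [AddCommGroup Y] [Module k Y]

/-- The relations `m b ⊗ n = m ⊗ b n`. -/
def balRel (ρ : RAct k B M) (σ : LAct k B N) : Submodule k (M ⊗[k] N) :=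
  Submodule.span k {x | ∃ (b : B) (m : M) (n : N), x = ρ (op b) m ⊗ₜ n - m ⊗ₜ σ b n}

/-- The tensor product `M ⊗_B N` of a right and a left `B`-module. -/
def BT (ρ : RAct k B M) (σ : LAct k B N) : Type _ := (M ⊗[k] N) ⧸ balRel ρ σ

variable {ρ : RAct k B M} {σ : LAct k B N} {ρ' : RAct k B M'} {σ' : LAct k B N'}

instance BT.addCommGroup : AddCommGroup (BT ρ σ) :=
  inferInstanceAs (AddCommGroup ((M ⊗[k] N) ⧸ balRel ρ σ))

instance BT.module : Module k (BT ρ σ) :=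
  inferInstanceAs (Module k ((M ⊗[k] N) ⧸ balRel ρ σ))

/-- `m ⊗_B n`, as a bilinear map. -/
def BT.mk (ρ : RAct k B M) (σ : LAct k B N) : M →ₗ[k] N →ₗ[k] BT ρ σ :=
  (TensorProduct.mk k M N).compr₂ (balRel ρ σ).mkQ

theorem BT.mk_bal (b : B) (m : M) (n : N) :
    BT.mk ρ σ (ρ (op b) m) n = BT.mk ρ σ m (σ b n) :=
  (Submodule.Quotient.eq (balRel ρ σ)).2 (Submodule.subset_span ⟨b, m, n, rfl⟩)

/-- The linear map on `M ⊗_B N` given by a balanced bilinear map. -/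
def BT.lift (φ : M →ₗ[k] N →ₗ[k] P) (h : ∀ (b : B) m n, φ (ρ (op b) m) n = φ m (σ b n)) :
    BT ρ σ →ₗ[k] P :=
  (balRel ρ σ).liftQ (TensorProduct.lift φ) (by
    refine Submodule.span_le.2 ?_
    rintro _ ⟨b, m, n, rfl⟩
    simp [h])

@[simp] theorem BT.lift_mk (φ : M →ₗ[k] N →ₗ[k] P)
    (h : ∀ (b : B) m n, φ (ρ (op b) m) n = φ m (σ b n)) (m : M) (n : N) :
    BT.lift φ h (BT.mk ρ σ m n) = φ m n :=
  TensorProduct.lift.tmul m n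

theorem BT.induction {p : BT ρ σ → Prop} (z : BT ρ σ) (hm : ∀ m n, p (BT.mk ρ σ m n))
    (h0 : p 0) (ha : ∀ x y, p x → p y → p (x + y)) : p z := by
  obtain ⟨t, rfl⟩ := (balRel ρ σ).mkQ_surjective z
  induction t using TensorProduct.induction_on with
  | zero => exact h0
  | tmul m n => exact hm m n
  | add x y hx hy => exact ha _ _ hx hy

theorem BT.hom_ext {f g : BT ρ σ →ₗ[k] P} (h : ∀ m n, f (BT.mk ρ σ m n) = g (BT.mk ρ σ m n)) :
    f = g := by
  ext z
  induction z using BT.induction with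
  | hm m n => exact h m n
  | h0 => simp
  | ha x y hx hy => simp [hx, hy]

/-- `f ⊗_B g` for a map `f` of right and a map `g` of left `B`-modules. -/
def BT.map (f : M →ₗ[k] M') (g : N →ₗ[k] N') (hf : ∀ (b : Bᵐᵒᵖ) m, f (ρ b m) = ρ' b (f m))
    (hg : ∀ b n, g (σ b n) = σ' b (g n)) : BT ρ σ →ₗ[k] BT ρ' σ' :=
  BT.lift ((BT.mk ρ' σ').compl₁₂ f g) (fun b m n => by simp [hf, hg, BT.mk_bal])

@[simp] theorem BT.map_mk (f : M →ₗ[k] M') (g : N →ₗ[k] N')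
    (hf : ∀ (b : Bᵐᵒᵖ) m, f (ρ b m) = ρ' b (f m))
    (hg : ∀ b n, g (σ b n) = σ' b (g n)) (m : M) (n : N) :
    BT.map f g hf hg (BT.mk ρ σ m n) = BT.mk ρ' σ' (f m) (g n) := by
  simp [BT.map]

/-- For bilinear maps `F : X × M → M'` and `G : Y × N → N'` which are `B`-linear in the second
variable, the map `m ⊗_B n ↦ (x, y) ↦ F(x, m) ⊗_B G(y, n)`. -/
def BT.bimap (F : X →ₗ[k] M →ₗ[k] M') (G : Y →ₗ[k] N →ₗ[k] N')
    (hF : ∀ x (b : Bᵐᵒᵖ) m, F x (ρ b m) = ρ' b (F x m))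
    (hG : ∀ y b n, G y (σ b n) = σ' b (G y n)) : BT ρ σ →ₗ[k] X →ₗ[k] Y →ₗ[k] BT ρ' σ' :=
  BT.lift
    (LinearMap.mk₂ k (fun m n => (BT.mk ρ' σ').compl₁₂ (F.flip m) (G.flip n))
      (fun _ _ _ => by ext; simp) (fun _ _ _ => by ext; simp)
      (fun _ _ _ => by ext; simp) (fun _ _ _ => by ext; simp))
    (fun b m n => by ext; simp [hF, hG, BT.mk_bal])

@[simp] theorem BT.bimap_mk (F : X →ₗ[k] M →ₗ[k] M') (G : Y →ₗ[k] N →ₗ[k] N')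
    (hF : ∀ x (b : Bᵐᵒᵖ) m, F x (ρ b m) = ρ' b (F x m))
    (hG : ∀ y b n, G y (σ b n) = σ' b (G y n)) (m : M) (n : N) (x : X) (y : Y) :
    BT.bimap F G hF hG (BT.mk ρ σ m n) x y = BT.mk ρ' σ' (F x m) (G y n) := by
  simp [BT.bimap]

theorem BT.bimap_apply (F : X →ₗ[k] M →ₗ[k] M') (G : Y →ₗ[k] N →ₗ[k] N')
    (hF : ∀ x (b : Bᵐᵒᵖ) m, F x (ρ b m) = ρ' b (F x m))
    (hG : ∀ y b n, G y (σ b n) = σ' b (G y n)) (z : BT ρ σ) (x : X) (y : Y) :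
    BT.bimap F G hF hG z x y = BT.map (F x) (G y) (hF x) (hG y) z := by
  induction z using BT.induction with
  | hm m n => simp
  | h0 => simp
  | ha a b ha hb => simp [ha, hb]

theorem BT.bimap_bal (F : X →ₗ[k] M →ₗ[k] M') (G : Y →ₗ[k] N →ₗ[k] N')
    (hF : ∀ x (b : Bᵐᵒᵖ) m, F x (ρ b m) = ρ' b (F x m))
    (hG : ∀ y b n, G y (σ b n) = σ' b (G y n)) {z : BT ρ σ} {f : M →ₗ[k] M} {g : N →ₗ[k] N}
    {hf : ∀ (b : Bᵐᵒᵖ) m, f (ρ b m) = ρ b (f m)} {hg : ∀ b n, g (σ b n) = σ b (g n)}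
    (hz : BT.map (ρ' := ρ) (σ' := σ) f LinearMap.id hf (fun _ _ => rfl) z =
      BT.map LinearMap.id g (fun _ _ => rfl) hg z)
    {x x' : X} {y y' : Y} (hx : ∀ m, F x' m = F x (f m)) (hy : ∀ n, G y' n = G y (g n)) :
    BT.bimap F G hF hG z x' y = BT.bimap F G hF hG z x y' := by
  have h1 : ∀ w : BT ρ σ, BT.bimap F G hF hG w x' y = BT.bimap F G hF hG
      (BT.map (ρ' := ρ) (σ' := σ) f LinearMap.id hf (fun _ _ => rfl) w) x y := fun w => by
    induction w using BT.induction with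
    | hm m n => simp [hx]
    | h0 => simp
    | ha a b ha hb => simp [ha, hb]
  have h2 : ∀ w : BT ρ σ, BT.bimap F G hF hG w x y' = BT.bimap F G hF hG
      (BT.map (ρ' := ρ) (σ' := σ) LinearMap.id g (fun _ _ => rfl) hg w) x y := fun w => by
    induction w using BT.induction with
    | hm m n => simp [hy]
    | h0 => simp
    | ha a b ha hb => simp [ha, hb]
  rw [h1, h2, hz]

/-- `m ⊗_B n ↦ x ↦ F(x, m) ⊗_B n`. -/
def BT.mapL (F : X →ₗ[k] M →ₗ[k] M') (hF : ∀ x (b : Bᵐᵒᵖ) m, F x (ρ b m) = ρ' b (F x m)) :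
    BT ρ σ →ₗ[k] X →ₗ[k] BT ρ' σ :=
  LinearMap.applyₗ (1 : k) ∘ₗ LinearMap.lflip.toLinearMap ∘ₗ
    BT.bimap F (LinearMap.lsmul k N) hF (fun _ _ _ => by simp)

@[simp] theorem BT.mapL_apply (F : X →ₗ[k] M →ₗ[k] M')
    (hF : ∀ x (b : Bᵐᵒᵖ) m, F x (ρ b m) = ρ' b (F x m)) (z : BT ρ σ) (x : X) :
    BT.mapL F hF z x = BT.map (F x) LinearMap.id (hF x) (fun _ _ => rfl) z := by
  induction z using BT.induction with
  | hm m n =>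
    exact (BT.bimap_mk (σ := σ) (σ' := σ) F (LinearMap.lsmul k N) hF (fun _ _ _ => by simp) m n x 1).trans (by simp)
  | h0 => simp
  | ha a b ha hb => simp [ha, hb]

/-- `m ⊗_B n ↦ y ↦ m ⊗_B G(y, n)`. -/
def BT.mapR (G : Y →ₗ[k] N →ₗ[k] N') (hG : ∀ y b n, G y (σ b n) = σ' b (G y n)) :
    BT ρ σ →ₗ[k] Y →ₗ[k] BT ρ σ' :=
  LinearMap.applyₗ (1 : k) ∘ₗ BT.bimap (LinearMap.lsmul k M) G (fun _ _ _ => by simp) hG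

@[simp] theorem BT.mapR_apply (G : Y →ₗ[k] N →ₗ[k] N')
    (hG : ∀ y b n, G y (σ b n) = σ' b (G y n)) (z : BT ρ σ) (y : Y) :
    BT.mapR G hG z y = BT.map LinearMap.id (G y) (fun _ _ => rfl) (hG y) z := by
  induction z using BT.induction with
  | hm m n =>
    exact (BT.bimap_mk (ρ := ρ) (ρ' := ρ) (LinearMap.lsmul k M) G (fun _ _ _ => by simp) hG m n 1 y).trans (by simp)
  | h0 => simp
  | ha a b ha hb => simp [ha, hb]

/-- The right `C`-action on `M ⊗_B N` given by a commuting right `C`-action on `N`. -/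
def BT.rightAct (ρ : RAct k B M) (σ : LAct k B N) (τ : RAct k C N)
    (h : ∀ b (c : Cᵐᵒᵖ) n, σ b (τ c n) = τ c (σ b n)) : RAct k C (BT ρ σ) :=
  AlgHom.ofLinearMap
    { toFun := fun c => BT.map (ρ := ρ) (σ := σ) (ρ' := ρ) (σ' := σ) LinearMap.id (τ c)
        (fun _ _ => rfl) (fun b n => (h b c n).symm)
      map_add' := fun _ _ => BT.hom_ext fun _ _ => by simp
      map_smul' := fun _ _ => BT.hom_ext fun _ _ => by simp }
    (BT.hom_ext fun _ _ => by simp) (fun _ _ => BT.hom_ext fun _ _ => by simp)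

@[simp] theorem BT.rightAct_mk (τ : RAct k C N)
    (h : ∀ b (c : Cᵐᵒᵖ) n, σ b (τ c n) = τ c (σ b n)) (c : Cᵐᵒᵖ) (m : M) (n : N) :
    BT.rightAct ρ σ τ h c (BT.mk ρ σ m n) = BT.mk ρ σ m (τ c n) := by
  simp [BT.rightAct]

/-- The left `C`-action on `M ⊗_B N` given by a commuting left `C`-action on `M`. -/
def BT.leftAct (ρ : RAct k B M) (σ : LAct k B N) (τ : LAct k C M)
    (h : ∀ c (b : Bᵐᵒᵖ) m, τ c (ρ b m) = ρ b (τ c m)) : LAct k C (BT ρ σ) :=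
  AlgHom.ofLinearMap
    { toFun := fun c => BT.map (ρ := ρ) (σ := σ) (ρ' := ρ) (σ' := σ) (τ c) LinearMap.id
        (fun b n => h c b n) (fun _ _ => rfl)
      map_add' := fun _ _ => BT.hom_ext fun _ _ => by simp
      map_smul' := fun _ _ => BT.hom_ext fun _ _ => by simp }
    (BT.hom_ext fun _ _ => by simp) (fun _ _ => BT.hom_ext fun _ _ => by simp)

@[simp] theorem BT.leftAct_mk (τ : LAct k C M)
    (h : ∀ c (b : Bᵐᵒᵖ) m, τ c (ρ b m) = ρ b (τ c m)) (c : C) (m : M) (n : N) :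
    BT.leftAct ρ σ τ h c (BT.mk ρ σ m n) = BT.mk ρ σ (τ c m) n := by
  simp [BT.leftAct]

/-- `m ⊗_B n ↦ p ↦ m ⊗_B (n ⊗_C p)`. -/
def BT.insert (ρ : RAct k B M) (σ : LAct k B N) (τ : RAct k C N) (π : LAct k C P)
    (h : ∀ b (c : Cᵐᵒᵖ) n, σ b (τ c n) = τ c (σ b n)) :
    BT ρ σ →ₗ[k] P →ₗ[k] BT ρ (BT.leftAct τ π σ h) :=
  BT.lift
    (LinearMap.mk₂ k (fun m n => (BT.mk ρ (BT.leftAct τ π σ h) m) ∘ₗ BT.mk τ π n)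
      (fun _ _ _ => by ext; simp) (fun _ _ _ => by ext; simp)
      (fun _ _ _ => by ext; simp) (fun _ _ _ => by ext; simp))
    (fun b m n => by ext p; simp [BT.mk_bal])

@[simp] theorem BT.insert_mk (τ : RAct k C N) (π : LAct k C P)
    (h : ∀ b (c : Cᵐᵒᵖ) n, σ b (τ c n) = τ c (σ b n)) (m : M) (n : N) (p : P) :
    BT.insert ρ σ τ π h (BT.mk ρ σ m n) p = BT.mk ρ _ m (BT.mk τ π n p) := by
  simp [BT.insert]

/-- The canonical isomorphism `(M ⊗_B N) ⊗_C P → M ⊗_B (N ⊗_C P)`, `(m ⊗ n) ⊗ p ↦ m ⊗ (n ⊗ p)`. -/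
def BT.assoc (ρ : RAct k B M) (σ : LAct k B N) (τ : RAct k C N) (π : LAct k C P)
    (h : ∀ b (c : Cᵐᵒᵖ) n, σ b (τ c n) = τ c (σ b n)) :
    BT (BT.rightAct ρ σ τ h) π →ₗ[k] BT ρ (BT.leftAct τ π σ h) :=
  BT.lift (BT.insert ρ σ τ π h) (fun c z p => by
    induction z using BT.induction with
    | hm m n => simp [BT.mk_bal]
    | h0 => simp
    | ha x y hx hy => simp [hx, hy])

@[simp] theorem BT.assoc_mk (τ : RAct k C N) (π : LAct k C P)
    (h : ∀ b (c : Cᵐᵒᵖ) n, σ b (τ c n) = τ c (σ b n)) (z : BT ρ σ) (p : P) :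
    BT.assoc ρ σ τ π h (BT.mk _ π z p) = BT.insert ρ σ τ π h z p :=
  BT.lift_mk _ _ z p

/-- Left multiplication in `H`, pulled back along an algebra map. -/
def lmulL {H : Type*} [Ring H] [Algebra k H] (f : B →ₐ[k] H) : LAct k B H :=
  (Algebra.lmul k H).comp f

/-- Right multiplication in `H`, pulled back along an algebra map `f : B → H`, is a right action. -/
def rmulR {H : Type*} [Ring H] [Algebra k H] (f : B →ₐ[k] H) : RAct k B H :=
  (Algebra.lsmul k k H).comp (AlgHom.op f)

/-- Left multiplication in `H` by `f b`, for an anti-homomorphism `f`, is a right action. -/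
def lmulR {H : Type*} [Ring H] [Algebra k H] (f : Bᵐᵒᵖ →ₐ[k] H) : RAct k B H :=
  (Algebra.lmul k H).comp f

/-- Right multiplication in `H` by `f b`, for an anti-homomorphism `f`, is a left action. -/
def rmulL {H : Type*} [Ring H] [Algebra k H] (f : Bᵐᵒᵖ →ₐ[k] H) : LAct k B H :=
  (Algebra.lsmul k k H).comp (AlgHom.opComm.symm f)

/-- The bilinear map `(y, x) ↦ x y`. -/
def mulFlip (k H : Type*) [CommRing k] [Ring H] [Algebra k H] : H →ₗ[k] H →ₗ[k] H :=
  (LinearMap.mul k H).flip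

@[simp] theorem mulFlip_apply {H : Type*} [Ring H] [Algebra k H] (x y : H) :
    mulFlip k H y x = x * y := (rfl)

@[simp] theorem lmulL_apply {H : Type*} [Ring H] [Algebra k H] (f : B →ₐ[k] H) (b : B) (h : H) :
    lmulL f b h = f b * h := (rfl)

@[simp] theorem rmulR_apply {H : Type*} [Ring H] [Algebra k H] (f : B →ₐ[k] H) (b : B) (h : H) :
    rmulR f (op b) h = h * f b := (rfl)

@[simp] theorem lmulR_apply {H : Type*} [Ring H] [Algebra k H] (f : Bᵐᵒᵖ →ₐ[k] H) (b : Bᵐᵒᵖ)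
    (h : H) : lmulR f b h = f b * h := (rfl)

@[simp] theorem rmulL_apply {H : Type*} [Ring H] [Algebra k H] (f : Bᵐᵒᵖ →ₐ[k] H) (b : B) (h : H) :
    rmulL f b h = h * f (op b) := (rfl)

section Equivariance

variable {H : Type*} [Ring H] [Algebra k H]

theorem mulRight_lmulR (f : Bᵐᵒᵖ →ₐ[k] H) (y : H) (b : Bᵐᵒᵖ) (h : H) :
    LinearMap.mulRight k y (lmulR f b h) = lmulR f b (LinearMap.mulRight k y h) := by
  simp [mul_assoc]

theorem mulRight_lmulL (f : B →ₐ[k] H) (y : H) (b : B) (h : H) :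
    LinearMap.mulRight k y (lmulL f b h) = lmulL f b (LinearMap.mulRight k y h) := by
  simp [mul_assoc]

theorem mulLeft_rmulR (f : B →ₐ[k] H) (y : H) (b : Bᵐᵒᵖ) (h : H) :
    LinearMap.mulLeft k y (rmulR f b h) = rmulR f b (LinearMap.mulLeft k y h) := by
  induction b; simp [mul_assoc]

theorem mulLeft_rmulL (f : Bᵐᵒᵖ →ₐ[k] H) (y : H) (b : B) (h : H) :
    LinearMap.mulLeft k y (rmulL f b h) = rmulL f b (LinearMap.mulLeft k y h) := by
  simp [mul_assoc]

theorem mulFlip_lmulR (f : Bᵐᵒᵖ →ₐ[k] H) (y : H) (b : Bᵐᵒᵖ) (h : H) :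
    mulFlip k H y (lmulR f b h) = lmulR f b (mulFlip k H y h) := by
  simp [mul_assoc]

theorem mulFlip_lmulL (f : B →ₐ[k] H) (y : H) (b : B) (h : H) :
    mulFlip k H y (lmulL f b h) = lmulL f b (mulFlip k H y h) := by
  simp [mul_assoc]

theorem mul_rmulR (f : B →ₐ[k] H) (y : H) (b : Bᵐᵒᵖ) (h : H) :
    LinearMap.mul k H y (rmulR f b h) = rmulR f b (LinearMap.mul k H y h) := by
  induction b; simp [mul_assoc]

theorem mul_rmulL (f : Bᵐᵒᵖ →ₐ[k] H) (y : H) (b : B) (h : H) :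
    LinearMap.mul k H y (rmulL f b h) = rmulL f b (LinearMap.mul k H y h) := by
  simp [mul_assoc]

theorem flip_act {M A : Type*} [AddCommGroup M] [Module k M] [AddCommGroup A] [Module k A]
    {mu : M →ₗ[k] A →ₗ[k] M} {ρ : RAct k B M}
    (h : ∀ a (b : Bᵐᵒᵖ) m, mu (ρ b m) a = ρ b (mu m a)) (a : A) (b : Bᵐᵒᵖ) (m : M) :
    mu.flip a (ρ b m) = ρ b (mu.flip a m) := by
  simp [h]

end Equivariance

end BT

/-! ### Corings and comodules -/

section Coring

variable {k : Type*} [CommRing k] {B : Type*} [Ring B] [Algebra k B]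
  {C : Type*} [Ring C] [Algebra k C]
  {M : Type*} [AddCommGroup M] [Module k M] {N : Type*} [AddCommGroup N] [Module k N]
  {P : Type*} [AddCommGroup P] [Module k P]

/-- Let `M` be a right `B`- and right `C`-module, `N` a `B`-`C` bimodule, `P` a left `C`-module, and
let `coB : M → M ⊗_B N`, `coC : M → M ⊗_C P` and `Δ : N → N ⊗_C P` be maps. The condition says that
`coB` is right `C`-linear, that `Δ` is left `B`-linear, and that
`(coB ⊗_C P) ∘ coC = (M ⊗_B Δ) ∘ coB` as maps `M → M ⊗_B N ⊗_C P`. -/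
structure Coassoc (rB : RAct k B M) (rC : RAct k C M) (lN : LAct k B N) (rN : RAct k C N)
    (lP : LAct k C P) (comm : ∀ b (c : Cᵐᵒᵖ) n, lN b (rN c n) = rN c (lN b n))
    (coB : M →ₗ[k] BT rB lN) (coC : M →ₗ[k] BT rC lP) (Δ : N →ₗ[k] BT rN lP) : Prop where
  right_linear : ∀ (c : Cᵐᵒᵖ) m, coB (rC c m) = BT.rightAct rB lN rN comm c (coB m)
  left_linear : ∀ b n, Δ (lN b n) = BT.leftAct rN lP lN comm b (Δ n)
  coassoc : ∀ m, BT.assoc rB lN rN lP comm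
      (BT.map coB LinearMap.id right_linear (fun _ _ => rfl) (coC m)) =
    BT.map LinearMap.id Δ (fun _ _ => rfl) left_linear (coB m)

/-- For a right `B`-module `M` and a left `B`-linear map `ε : N → B`, the composite of
`M ⊗_B ε` with the isomorphism `M ⊗_B B ≅ M`, that is, `m ⊗ n ↦ m ε(n)`. -/
def BT.contr (rM : RAct k B M) (lN : LAct k B N) (ε : N →ₗ[k] B)
    (hε : ∀ b n, ε (lN b n) = b * ε n) : BT rM lN →ₗ[k] M :=
  BT.lift (rM.toLinearMap ∘ₗ (opLinearEquiv k).toLinearMap ∘ₗ ε).flip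
    (fun b m n => by simp [hε])

@[simp] theorem BT.contr_mk (rM : RAct k B M) (lN : LAct k B N) (ε : N →ₗ[k] B)
    (hε : ∀ b n, ε (lN b n) = b * ε n) (m : M) (n : N) :
    BT.contr rM lN ε hε (BT.mk rM lN m n) = rM (op (ε n)) m :=
  BT.lift_mk _ _ m n

/-- The `B`-`B` bimodule `N` is a `B`-coring with coproduct `Δ` and counit `ε`. -/
structure IsCoring (l : LAct k B N) (r : RAct k B N) (Δ : N →ₗ[k] BT r l) (ε : N →ₗ[k] B) :
    Prop where
  comm : ∀ b (b' : Bᵐᵒᵖ) n, l b (r b' n) = r b' (l b n)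
  coassoc : Coassoc r r l r l comm Δ Δ Δ
  counit_left : ∀ b n, ε (l b n) = b * ε n
  counit_right : ∀ b n, ε (r (op b) n) = ε n * b
  counit_comul : ∀ n, BT.lift (l.toLinearMap ∘ₗ ε)
    (fun b m n => by simp [counit_right]) (Δ n) = n
  comul_counit : ∀ n, BT.contr r l ε counit_left (Δ n) = n

/-- `co : M → M ⊗_B N` is a right coaction of the `B`-coring `N` on the right `B`-module `M`. -/
structure IsComodule {l : LAct k B N} {r : RAct k B N} {Δ : N →ₗ[k] BT r l} {ε : N →ₗ[k] B}
    (hN : IsCoring l r Δ ε) (rM : RAct k B M) (co : M →ₗ[k] BT rM l) : Prop where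
  coassoc : Coassoc rM rM l r l hN.comm co co Δ
  counit : ∀ m, BT.contr rM l ε hN.counit_left (co m) = m

end Coring

/-! ### Bialgebroids and Hopf algebroids -/

section Bialgebroid

variable (k : Type*) [CommRing k] (L : Type*) [Ring L] [Algebra k L] (R : Type*) [Ring R]
  [Algebra k R] (H : Type*) [Ring H] [Algebra k H]

/-- A left bialgebroid `(H, s, t, Δ, ε)` over the `k`-algebra `L`. The bimodule structure of the
underlying `L`-coring is `l h l' = s(l) t(l') h`. -/
structure LeftBialgebroid where
  /-- source map -/
  s : L →ₐ[k] H
  /-- target map, an anti-homomorphism -/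
  t : Lᵐᵒᵖ →ₐ[k] H
  commute : ∀ l l', s l * t l' = t l' * s l
  /-- coproduct -/
  Δ : H →ₗ[k] BT (lmulR t) (lmulL s)
  /-- counit -/
  ε : H →ₗ[k] L
  isCoring : IsCoring (lmulL s) (lmulR t) Δ ε
  /-- `h₁ t(l) ⊗ h₂ = h₁ ⊗ h₂ s(l)` -/
  takeuchi : ∀ l h, BT.map (LinearMap.mulRight k (t (op l))) LinearMap.id
      (mulRight_lmulR t _) (fun _ _ => rfl) (Δ h) =
    BT.map LinearMap.id (LinearMap.mulRight k (s l)) (fun _ _ => rfl)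
      (mulRight_lmulL s _) (Δ h)
  Δ_one : Δ 1 = BT.mk _ _ 1 1
  /-- `Δ(h h') = h₁ h'₁ ⊗ h₂ h'₂` -/
  Δ_mul : ∀ h h', Δ (h * h') = BT.lift
    (BT.bimap (mulFlip k H) (mulFlip k H) (mulFlip_lmulR t) (mulFlip_lmulL s) (Δ h))
    (fun l _ _ => BT.bimap_bal _ _ _ _ (takeuchi l h) (fun _ => by simp [mul_assoc])
      (fun _ => by simp [mul_assoc])) (Δ h')
  ε_one : ε 1 = 1
  ε_mul_s : ∀ h h', ε (h * s (ε h')) = ε (h * h')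
  ε_mul_t : ∀ h h', ε (h * t (op (ε h'))) = ε (h * h')

/-- A right bialgebroid `(H, s, t, Δ, ε)` over the `k`-algebra `R`. The bimodule structure of the
underlying `R`-coring is `r h r' = h s(r') t(r)`. -/
structure RightBialgebroid where
  /-- source map -/
  s : R →ₐ[k] H
  /-- target map, an anti-homomorphism -/
  t : Rᵐᵒᵖ →ₐ[k] H
  commute : ∀ r r', s r * t r' = t r' * s r
  /-- coproduct -/
  Δ : H →ₗ[k] BT (rmulR s) (rmulL t)
  /-- counit -/
  ε : H →ₗ[k] R
  isCoring : IsCoring (rmulL t) (rmulR s) Δ ε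
  /-- `s(r) h₁ ⊗ h₂ = h₁ ⊗ t(r) h₂` -/
  takeuchi : ∀ r h, BT.map (LinearMap.mulLeft k (s r)) LinearMap.id
      (mulLeft_rmulR s _) (fun _ _ => rfl) (Δ h) =
    BT.map LinearMap.id (LinearMap.mulLeft k (t (op r))) (fun _ _ => rfl)
      (mulLeft_rmulL t _) (Δ h)
  Δ_one : Δ 1 = BT.mk _ _ 1 1
  /-- `Δ(h h') = h₁ h'₁ ⊗ h₂ h'₂` -/
  Δ_mul : ∀ h h', Δ (h * h') = BT.lift
    (BT.bimap (LinearMap.mul k H) (LinearMap.mul k H) (mul_rmulR s) (mul_rmulL t) (Δ h'))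
    (fun r _ _ => BT.bimap_bal _ _ _ _ (takeuchi r h') (fun _ => by simp [mul_assoc])
      (fun _ => by simp [mul_assoc])) (Δ h)
  ε_one : ε 1 = 1
  ε_s_mul : ∀ h h', ε (s (ε h) * h') = ε (h * h')
  ε_t_mul : ∀ h h', ε (t (op (ε h)) * h') = ε (h * h')

variable {k L R H} in
theorem lmulL_rmulR_comm (f : L →ₐ[k] H) (g : R →ₐ[k] H) (l : L) (r : Rᵐᵒᵖ) (h : H) :
    lmulL f l (rmulR g r h) = rmulR g r (lmulL f l h) := by
  induction r; simp [mul_assoc]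

variable {k L R H} in
theorem rmulL_lmulR_comm (f : Rᵐᵒᵖ →ₐ[k] H) (g : Lᵐᵒᵖ →ₐ[k] H) (r : R) (l : Lᵐᵒᵖ) (h : H) :
    rmulL f r (lmulR g l h) = lmulR g l (rmulL f r h) := by
  simp [mul_assoc]

/-- A Hopf algebroid with total algebra `H` over the base algebras `L` and `R`. The antipode is not
required to be bijective, and no purity is required. -/
structure HopfAlgebroid where
  /-- the constituent left bialgebroid -/
  left : LeftBialgebroid k L H
  /-- the constituent right bialgebroid -/
  right : RightBialgebroid k R H
  /-- the antipode -/
  S : H →ₗ[k] H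
  s_ε_t_left : ∀ r, left.s (left.ε (right.t (op r))) = right.t (op r)
  t_ε_s_left : ∀ r, left.t (op (left.ε (right.s r))) = right.s r
  s_ε_t_right : ∀ l, right.s (right.ε (left.t (op l))) = left.t (op l)
  t_ε_s_right : ∀ l, right.t (op (right.ε (left.s l))) = left.s l
  /-- `(Δ_L ⊗_R H) ∘ Δ_R = (H ⊗_L Δ_R) ∘ Δ_L` -/
  coassoc_left_right : Coassoc (lmulR left.t) (rmulR right.s) (lmulL left.s) (rmulR right.s)
    (rmulL right.t) (lmulL_rmulR_comm _ _) left.Δ right.Δ right.Δ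
  /-- `(Δ_R ⊗_L H) ∘ Δ_L = (H ⊗_R Δ_L) ∘ Δ_R` -/
  coassoc_right_left : Coassoc (rmulR right.s) (lmulR left.t) (rmulL right.t) (lmulR left.t)
    (lmulL left.s) (rmulL_lmulR_comm _ _) right.Δ left.Δ left.Δ
  S_twist : ∀ l r h, S (left.t (op l) * h * right.t (op r)) = right.s r * S h * left.s l
  /-- `S(h₁) h₂ = s_R(ε_R(h))` for the coproduct of the left bialgebroid -/
  antipode_left : ∀ h, BT.lift ((LinearMap.mul k H).comp S)
    (fun l x y => by simpa [mul_assoc] using congrArg (· * y) (S_twist l 1 x)) (left.Δ h) = right.s (right.ε h)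
  /-- `h₁ S(h₂) = s_L(ε_L(h))` for the coproduct of the right bialgebroid -/
  antipode_right : ∀ h, BT.lift ((LinearMap.mul k H).compl₂ S)
    (fun r x y => by simpa [mul_assoc] using congrArg (x * ·) (S_twist 1 r y).symm) (right.Δ h) = left.s (left.ε h)

end Bialgebroid

section Coring

variable {k : Type*} [CommRing k] {B : Type*} [Ring B] [Algebra k B]
  {M : Type*} [AddCommGroup M] [Module k M] {N : Type*} [AddCommGroup N] [Module k N]

/-- If `u` is an endomorphism of a comodule `M` with `co(u m) = m₀ ⊗ v(m₁)`, and
`v(n₁) ⊗ n₂ = n₁ ⊗ v'(n₂)` in the coring, then `u(m₀) ⊗ m₁ = m₀ ⊗ v'(m₁)`. -/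
theorem IsComodule.takeuchi {l : LAct k B N} {r : RAct k B N} {Δ : N →ₗ[k] BT r l} {ε : N →ₗ[k] B}
    {hN : IsCoring l r Δ ε} {rM : RAct k B M} {co : M →ₗ[k] BT rM l} (h : IsComodule hN rM co)
    (u : M →ₗ[k] M) (hu : ∀ (b : Bᵐᵒᵖ) m, u (rM b m) = rM b (u m)) (v v' : N →ₗ[k] N)
    (hvl : ∀ b n, v (l b n) = l b (v n)) (hvr : ∀ (b : Bᵐᵒᵖ) n, v (r b n) = r b (v n))
    (hvl' : ∀ b n, v' (l b n) = l b (v' n))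
    (hΔ : ∀ n, BT.map (ρ' := r) (σ' := l) v LinearMap.id hvr (fun _ _ => rfl) (Δ n) =
      BT.map LinearMap.id v' (fun _ _ => rfl) hvl' (Δ n))
    (huv : ∀ m, co (u m) = BT.map LinearMap.id v (fun _ _ => rfl) hvl (co m)) (m : M) :
    BT.map (ρ' := rM) (σ' := l) u LinearMap.id hu (fun _ _ => rfl) (co m) =
      BT.map LinearMap.id v' (fun _ _ => rfl) hvl' (co m) := by
  let e : BT r l →ₗ[k] N := BT.lift (l.toLinearMap ∘ₗ ε)
    (fun b m n => by simp [hN.counit_right])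
  have he : ∀ a b, e (BT.mk r l a b) = l (ε a) b := fun a b => BT.lift_mk _ _ a b
  let φ : BT r l →ₗ[k] N := e ∘ₗ BT.map v LinearMap.id hvr (fun _ _ => rfl)
  have hφ : ∀ a b, φ (BT.mk r l a b) = l (ε (v a)) b := fun a b => by simp [φ, he]
  have hφl : ∀ b z, φ (BT.leftAct r l l hN.comm b z) = l b (φ z) := fun b z => by
    induction z using BT.induction with
    | hm m n => simp [hφ, hvl, hN.counit_left]
    | h0 => simp
    | ha x y hx hy => simp only [map_add, hx, hy]
  have hφΔ : ∀ n, φ (Δ n) = v' n := fun n => by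
    have h1 : ∀ z, e (BT.map LinearMap.id v' (fun _ _ => rfl) hvl' z) = v' (e z) := fun z => by
      induction z using BT.induction with
      | hm m n => simp [he, hvl']
      | h0 => simp
      | ha x y hx hy => simp only [map_add, hx, hy]
    calc φ (Δ n) = e (BT.map LinearMap.id v' (fun _ _ => rfl) hvl' (Δ n)) := by
          simp only [φ, LinearMap.comp_apply, hΔ]
      _ = v' n := by rw [h1, show e (Δ n) = n from hN.counit_comul n]
  have key := congrArg (BT.map (ρ' := rM) (σ' := l) LinearMap.id φ (fun _ _ => rfl) hφl)
    (h.coassoc.coassoc m)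
  have hR : ∀ x, BT.map (ρ' := rM) (σ' := l) LinearMap.id φ (fun _ _ => rfl) hφl
      (BT.map LinearMap.id Δ (fun _ _ => rfl) h.coassoc.left_linear x) =
      BT.map LinearMap.id v' (fun _ _ => rfl) hvl' x := fun x => by
    induction x using BT.induction with
    | hm m n => simp [hφΔ]
    | h0 => simp
    | ha x y hx hy => simp only [map_add, hx, hy]
  have hL0 : ∀ y p, BT.map (ρ' := rM) (σ' := l) LinearMap.id φ (fun _ _ => rfl) hφl
      (BT.insert rM l r l hN.comm y p) =
      BT.mk rM l (BT.contr rM l ε hN.counit_left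
        (BT.map LinearMap.id v (fun _ _ => rfl) hvl y)) p := fun y p => by
    induction y using BT.induction with
    | hm m n => simp [hφ, BT.mk_bal]
    | h0 => simp
    | ha x y hx hy => simp only [map_add, LinearMap.add_apply, hx, hy]
  have hL : ∀ z, BT.map (ρ' := rM) (σ' := l) LinearMap.id φ (fun _ _ => rfl) hφl
      (BT.assoc rM l r l hN.comm
        (BT.map co LinearMap.id h.coassoc.right_linear (fun _ _ => rfl) z)) =
      BT.map u LinearMap.id hu (fun _ _ => rfl) z := fun z => by
    induction z using BT.induction with
    | hm m n =>
      rw [BT.map_mk, BT.assoc_mk, LinearMap.id_apply, hL0, ← huv, h.counit]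
      simp
    | h0 => simp
    | ha x y hx hy => simp only [map_add, hx, hy]
  rw [hR, hL] at key
  exact key

end Coring

section Comodule

variable {k : Type*} [CommRing k] {L : Type*} [Ring L] [Algebra k L] {R : Type*} [Ring R]
  [Algebra k R] {H : Type*} [Ring H] [Algebra k H]

namespace HopfAlgebroid

variable (𝓗 : HopfAlgebroid k L R H)

/-- left `L`-action `l h = s_L(l) h` -/
abbrev lL : LAct k L H := lmulL 𝓗.left.s
/-- right `L`-action `h l = t_L(l) h` -/
abbrev rL : RAct k L H := lmulR 𝓗.left.t
/-- left `R`-action `r h = h t_R(r)` -/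
abbrev lR : LAct k R H := rmulL 𝓗.right.t
/-- right `R`-action `h r = h s_R(r)` -/
abbrev rR : RAct k R H := rmulR 𝓗.right.s

theorem ε_s_right (r : R) : 𝓗.right.ε (𝓗.right.s r) = r := by
  simpa [𝓗.right.ε_one] using 𝓗.right.isCoring.counit_right r 1

theorem ε_s_left (l : L) : 𝓗.left.ε (𝓗.left.s l) = l := by
  simpa [𝓗.left.ε_one] using 𝓗.left.isCoring.counit_left l 1

end HopfAlgebroid

/-- A right comodule `M` of the Hopf algebroid: a right `R`- and right `L`-module, with a coaction
`coR : m ↦ m⁰ ⊗_R m¹` of the right bialgebroid and a coaction `coL : m ↦ m₀ ⊗_L m₁` of the left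
bialgebroid, each being a comodule map for the other one. -/
structure HComodule (𝓗 : HopfAlgebroid k L R H) (M : Type*) [AddCommGroup M] [Module k M] where
  /-- right `R`-action -/
  actR : RAct k R M
  /-- right `L`-action -/
  actL : RAct k L M
  /-- coaction of the right bialgebroid -/
  coR : M →ₗ[k] BT actR 𝓗.lR
  /-- coaction of the left bialgebroid -/
  coL : M →ₗ[k] BT actL 𝓗.lL
  isComoduleR : IsComodule 𝓗.right.isCoring actR coR
  isComoduleL : IsComodule 𝓗.left.isCoring actL coL
  /-- `coR(m l) = m⁰ ⊗_R t_L(l) m¹` and `(coR ⊗_L H) ∘ coL = (M ⊗_R Δ_L) ∘ coR` -/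
  coassocRL : Coassoc actR actL 𝓗.lR 𝓗.rL 𝓗.lL (rmulL_lmulR_comm _ _) coR coL 𝓗.left.Δ
  /-- `coL(m r) = m₀ ⊗_L m₁ s_R(r)` and `(coL ⊗_R H) ∘ coR = (M ⊗_L Δ_R) ∘ coL` -/
  coassocLR : Coassoc actL actR 𝓗.lL 𝓗.rR 𝓗.lR (lmulL_rmulR_comm _ _) coL coR 𝓗.right.Δ

namespace HComodule

variable {𝓗 : HopfAlgebroid k L R H} {M : Type*} [AddCommGroup M] [Module k M]
  {M' : Type*} [AddCommGroup M'] [Module k M'] {A : Type*} [AddCommGroup A] [Module k A]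

/-- A `k`-linear map is a morphism of `𝓗`-comodules if it is right `R`- and right `L`-linear and
commutes with both coactions. -/
structure IsHom (X : HComodule 𝓗 M) (X' : HComodule 𝓗 M') (f : M →ₗ[k] M') : Prop where
  actR : ∀ (r : Rᵐᵒᵖ) m, f (X.actR r m) = X'.actR r (f m)
  actL : ∀ (l : Lᵐᵒᵖ) m, f (X.actL l m) = X'.actL l (f m)
  coR : ∀ m, X'.coR (f m) = BT.map f LinearMap.id actR (fun _ _ => rfl) (X.coR m)
  coL : ∀ m, X'.coL (f m) = BT.map f LinearMap.id actL (fun _ _ => rfl) (X.coL m)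

theorem act_comm (X : HComodule 𝓗 M) (r : Rᵐᵒᵖ) (l : Lᵐᵒᵖ) (m : M) :
    X.actR r (X.actL l m) = X.actL l (X.actR r m) := by
  have h : ∀ z, BT.rightAct X.actR 𝓗.lR 𝓗.rR 𝓗.right.isCoring.comm r
      (BT.rightAct X.actR 𝓗.lR 𝓗.rL (rmulL_lmulR_comm _ _) l z) =
      BT.rightAct X.actR 𝓗.lR 𝓗.rL (rmulL_lmulR_comm _ _) l
      (BT.rightAct X.actR 𝓗.lR 𝓗.rR 𝓗.right.isCoring.comm r z) := fun z => by
    induction z using BT.induction with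
    | hm m n => induction r; simp [mul_assoc]
    | h0 => simp
    | ha x y hx hy => simp only [map_add, hx, hy]
  have e : X.coR (X.actR r (X.actL l m)) = X.coR (X.actL l (X.actR r m)) := by
    rw [X.isComoduleR.coassoc.right_linear, X.coassocRL.right_linear, X.coassocRL.right_linear,
      X.isComoduleR.coassoc.right_linear]
    exact h _
  rw [← X.isComoduleR.counit (X.actR r _), e, X.isComoduleR.counit]

/-- `m⁰ l ⊗_R m¹ = m⁰ ⊗_R t_R(r) m¹` for `r = ε_R(t_L(l))` -/
theorem takeuchiR (X : HComodule 𝓗 M) (l : L) (m : M) :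
    BT.map (ρ' := X.actR) (σ' := 𝓗.lR) (X.actL (op l)) LinearMap.id
      (fun r m => (X.act_comm r (op l) m).symm) (fun _ _ => rfl) (X.coR m) =
    BT.map LinearMap.id
      (LinearMap.mulLeft k (𝓗.right.t (op (𝓗.right.ε (𝓗.left.t (op l))))))
      (fun _ _ => rfl) (mulLeft_rmulL _ _) (X.coR m) := by
  refine X.isComoduleR.takeuchi _ _ (LinearMap.mulLeft k (𝓗.left.t (op l))) _
    (mulLeft_rmulL _ _) (mulLeft_rmulR _ _) _ (fun h => ?_)
    (fun m => X.coassocRL.right_linear (op l) m) m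
  have := 𝓗.right.takeuchi (𝓗.right.ε (𝓗.left.t (op l))) h
  simp only [𝓗.s_ε_t_right] at this
  exact this

/-- `m₀ r ⊗_L m₁ = m₀ ⊗_L m₁ s_L(l)` for `r = ε_R(t_L(l))` -/
theorem takeuchiL (X : HComodule 𝓗 M) (l : L) (m : M) :
    BT.map (ρ' := X.actL) (σ' := 𝓗.lL) (X.actR (op (𝓗.right.ε (𝓗.left.t (op l))))) LinearMap.id
      (fun _ _ => X.act_comm _ _ _) (fun _ _ => rfl) (X.coL m) =
    BT.map LinearMap.id (LinearMap.mulRight k (𝓗.left.s l))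
      (fun _ _ => rfl) (mulRight_lmulL _ _) (X.coL m) := by
  refine X.isComoduleL.takeuchi _ _ (LinearMap.mulRight k (𝓗.left.t (op l))) _
    (mulRight_lmulL _ _) (mulRight_lmulR _ _) _
    (fun h => 𝓗.left.takeuchi l h) (fun m => ?_) m
  rw [X.coassocLR.right_linear]
  have : LinearMap.mulRight k (𝓗.left.t (op l)) =
      𝓗.rR (op (𝓗.right.ε (𝓗.left.t (op l)))) := by
    ext; simp [𝓗.s_ε_t_right]
  simp only [this]
  rfl

end HComodule

end Comodule

/-! ### Comodule algebras, coinvariants, cleft extensions -/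

section ComoduleAlgebra

variable {k : Type*} [CommRing k] {L : Type*} [Ring L] [Algebra k L] {R : Type*} [Ring R]
  [Algebra k R] {H : Type*} [Ring H] [Algebra k H]

namespace HopfAlgebroid

variable (𝓗 : HopfAlgebroid k L R H)

theorem ε_t_left (l : L) : 𝓗.left.ε (𝓗.left.t (op l)) = l := by
  simpa [𝓗.left.ε_one] using 𝓗.left.isCoring.counit_right l 1

theorem ε_t_ε_s (r : R) : 𝓗.right.ε (𝓗.left.t (op (𝓗.left.ε (𝓗.right.s r)))) = r := by
  rw [𝓗.t_ε_s_left, 𝓗.ε_s_right]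

theorem ε_s_ε_t (l : L) : 𝓗.left.ε (𝓗.right.s (𝓗.right.ε (𝓗.left.t (op l)))) = l := by
  rw [𝓗.s_ε_t_right, 𝓗.ε_t_left]

theorem S_one : 𝓗.S 1 = 1 := by
  have h := 𝓗.antipode_left 1
  rw [𝓗.left.Δ_one, 𝓗.right.ε_one, BT.lift_mk] at h
  simpa using h

/-- The regular comodule `H`, with the coproducts as coactions. -/
def regularComodule : HComodule 𝓗 H where
  actR := 𝓗.rR
  actL := 𝓗.rL
  coR := 𝓗.right.Δ
  coL := 𝓗.left.Δ
  isComoduleR := ⟨𝓗.right.isCoring.coassoc, 𝓗.right.isCoring.comul_counit⟩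
  isComoduleL := ⟨𝓗.left.isCoring.coassoc, 𝓗.left.isCoring.comul_counit⟩
  coassocRL := 𝓗.coassoc_right_left
  coassocLR := 𝓗.coassoc_left_right

end HopfAlgebroid

namespace HComodule

variable {𝓗 : HopfAlgebroid k L R H} {M : Type*} [AddCommGroup M] [Module k M]
  {A : Type*} [AddCommGroup A] [Module k A]

/-- The map `mu : M × A → M` induces a morphism of `𝓗`-comodules `M ⊗_R A → M`. Here `M ⊗_R A` is
the tensor product in the monoidal category of `𝓗`-comodules: it is taken over `R`, where the left
`R`-action on a comodule is `r a = a ε_L(s_R(r))`, its right `R`-action is that of `A`, its right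
`L`-action is that of `M`, and its coactions are `m ⊗ a ↦ m⁰ ⊗ a⁰ ⊗_R m¹ a¹` and
`m ⊗ a ↦ m₀ ⊗ a₀ ⊗_L m₁ a₁`. -/
structure IsAction (X : HComodule 𝓗 M) (Z : HComodule 𝓗 A) (mu : M →ₗ[k] A →ₗ[k] M) : Prop where
  balanced : ∀ (r : R) m a,
    mu (X.actR (op r) m) a = mu m (Z.actL (op (𝓗.left.ε (𝓗.right.s r))) a)
  actR : ∀ m (r : Rᵐᵒᵖ) a, mu m (Z.actR r a) = X.actR r (mu m a)
  actL : ∀ a (l : Lᵐᵒᵖ) m, mu (X.actL l m) a = X.actL l (mu m a)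
  /-- `coR(m a) = m⁰ a⁰ ⊗_R m¹ a¹` -/
  coR : ∀ m a, X.coR (mu m a) = BT.lift
    (BT.bimap mu (LinearMap.mul k H) actR (mul_rmulL _) (Z.coR a))
    (fun r _ _ => BT.bimap_bal _ _ _ _ (Z.takeuchiR (𝓗.left.ε (𝓗.right.s r)) a)
      (balanced r _) (fun _ => by simp [mul_assoc, 𝓗.ε_t_ε_s])) (X.coR m)
  /-- `coL(m a) = m₀ a₀ ⊗_L m₁ a₁` -/
  coL : ∀ m a, X.coL (mu m a) = BT.lift
    (BT.bimap mu.flip (mulFlip k H) (flip_act actL) (mulFlip_lmulL _) (X.coL m))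
    (fun l _ _ => BT.bimap_bal _ _ _ _ (X.takeuchiL l m)
      (fun _ => by simp [balanced, 𝓗.ε_s_ε_t]) (fun _ => by simp [mul_assoc])) (Z.coL a)

/-- An element which is coinvariant for the right bialgebroid is also coinvariant for the left
bialgebroid. -/
theorem coinvL (X : HComodule 𝓗 M) {m : M} (hm : X.coR m = BT.mk _ _ m 1) :
    X.coL m = BT.mk _ _ m 1 := by
  have hS : ∀ (r : R) h, 𝓗.S (𝓗.lR r h) = 𝓗.right.s r * 𝓗.S h := fun r h => by
    simpa using 𝓗.S_twist 1 r h
  let ψ : BT 𝓗.rR 𝓗.lR →ₗ[k] H := BT.lift ((LinearMap.mul k H).compl₂ 𝓗.S) (fun r x y => by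
    simp [← hS, mul_assoc])
  have hψ : ∀ x y, ψ (BT.mk _ _ x y) = x * 𝓗.S y := fun x y => BT.lift_mk _ _ x y
  have hψΔ : ∀ h, ψ (𝓗.right.Δ h) = 𝓗.left.s (𝓗.left.ε h) := 𝓗.antipode_right
  have hψl : ∀ b z, ψ (BT.leftAct 𝓗.rR 𝓗.lR 𝓗.lL (lmulL_rmulR_comm _ _) b z) = 𝓗.lL b (ψ z) :=
    fun b z => by
      induction z using BT.induction with
      | hm m n => simp [hψ, mul_assoc]
      | h0 => simp
      | ha x y hx hy => simp only [map_add, hx, hy]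
  have key := congrArg (BT.map (ρ' := X.actL) (σ' := 𝓗.lL) LinearMap.id ψ (fun _ _ => rfl) hψl)
    (X.coassocLR.coassoc m)
  rw [hm] at key
  have hR : ∀ z, BT.map (ρ' := X.actL) (σ' := 𝓗.lL) LinearMap.id ψ (fun _ _ => rfl) hψl
      (BT.map LinearMap.id 𝓗.right.Δ (fun _ _ => rfl) X.coassocLR.left_linear z) =
      BT.mk _ _ (BT.contr X.actL 𝓗.lL 𝓗.left.ε 𝓗.left.isCoring.counit_left z) 1 := fun z => by
    induction z using BT.induction with
    | hm m n => simp [hψΔ, BT.mk_bal]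
    | h0 => simp
    | ha x y hx hy => simp only [map_add, LinearMap.add_apply, hx, hy]
  have hL : ∀ z, BT.map (ρ' := X.actL) (σ' := 𝓗.lL) LinearMap.id ψ (fun _ _ => rfl) hψl
      (BT.insert X.actL 𝓗.lL 𝓗.rR 𝓗.lR (lmulL_rmulR_comm _ _) z 1) = z := fun z => by
    induction z using BT.induction with
    | hm m n => simp [hψ, 𝓗.S_one]
    | h0 => simp
    | ha x y hx hy => simp only [map_add, LinearMap.add_apply, hx, hy]
  rw [hR, X.isComoduleL.counit, BT.map_mk, BT.assoc_mk, LinearMap.id_apply, hL] at key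
  exact key

end HComodule

/-- A comodule algebra of the Hopf algebroid, that is, a monoid in the monoidal category of
`𝓗`-comodules: an `R`-ring `A` which is an `𝓗`-comodule whose underlying `R`-`R` bimodule
is that of the `R`-ring (the left action being `r a = a ε_L(s_R(r))`), such that the
multiplication `A ⊗_R A → A` and the unit `R → A` are comodule maps. -/
structure ComoduleAlgebra (𝓗 : HopfAlgebroid k L R H) (A : Type*) [Ring A] [Algebra k A] where
  /-- the underlying comodule -/
  com : HComodule 𝓗 A
  /-- the `R`-ring structure -/
  η : R →ₐ[k] A
  actR_eq : ∀ r a, com.actR (op r) a = a * η r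
  actL_eq : ∀ r a, com.actL (op (𝓗.left.ε (𝓗.right.s r))) a = η r * a
  coR_one : com.coR 1 = BT.mk _ _ 1 1
  coL_one : com.coL 1 = BT.mk _ _ 1 1
  isAction : com.IsAction com (LinearMap.mul k A)

/-- The comodule algebra `H`. -/
def HopfAlgebroid.regular (𝓗 : HopfAlgebroid k L R H) : ComoduleAlgebra 𝓗 H where
  com := 𝓗.regularComodule
  η := 𝓗.right.s
  actR_eq _ _ := rfl
  actL_eq r a := by
    change 𝓗.left.t _ * a = _
    rw [𝓗.t_ε_s_left]
  coR_one := 𝓗.right.Δ_one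
  coL_one := 𝓗.left.Δ_one
  isAction :=
    { balanced := fun r m a => by
        change m * 𝓗.right.s r * a = m * (𝓗.left.t _ * a)
        rw [𝓗.t_ε_s_left, mul_assoc]
      actR := fun m r a => (mul_assoc m a _).symm
      actL := fun a l m => mul_assoc _ m a
      coR := 𝓗.right.Δ_mul
      coL := 𝓗.left.Δ_mul }

namespace ComoduleAlgebra

variable {𝓗 : HopfAlgebroid k L R H} {A : Type*} [Ring A] [Algebra k A] (𝒜 : ComoduleAlgebra 𝓗 A)

/-- The subalgebra of coinvariants of the right bialgebroid, `{a | a⁰ ⊗_R a¹ = a ⊗_R 1}`. -/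
def coinvariants : Subalgebra k A where
  carrier := {a | 𝒜.com.coR a = BT.mk _ _ a 1}
  mul_mem' {a b} ha hb := by
    have h := 𝒜.isAction.coR a b
    rw [Set.mem_ofPred_eq] at ha hb
    rw [ha, BT.lift_mk, hb, BT.bimap_mk] at h
    simpa using h
  add_mem' {a b} ha hb := by
    rw [Set.mem_ofPred_eq] at ha hb ⊢
    simp [ha, hb]
  algebraMap_mem' c := by
    simp [Algebra.algebraMap_eq_smul_one, 𝒜.coR_one]

/-- The data exhibiting `T ⊆ A` as a cleft extension, where `T` is the algebra of coinvariants: an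
`L`-ring structure on `A` such that `T` is an `L`-subring, a left `L`-linear `𝓗`-comodule map
`j : H → A`, and a convolution inverse `j'` of `j`, which is left `R`- and right `L`-linear. -/
structure Cleaving where
  /-- the `L`-ring structure -/
  ηL : L →ₐ[k] A
  ηL_mem : ∀ l, ηL l ∈ 𝒜.coinvariants
  /-- the cleaving map -/
  j : H →ₗ[k] A
  j_left : ∀ l h, j (𝓗.left.s l * h) = ηL l * j h
  j_hom : 𝓗.regularComodule.IsHom 𝒜.com j
  /-- the convolution inverse -/
  j' : H →ₗ[k] A
  j'_left : ∀ r h, j' (h * 𝓗.right.t (op r)) = 𝒜.η r * j' h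
  j'_right : ∀ l h, j' (𝓗.left.t (op l) * h) = j' h * ηL l
  /-- `j(h¹) j'(h²) = η_L(ε_L(h))` for the coproduct of the right bialgebroid -/
  j_mul_j' : ∀ h, BT.lift ((LinearMap.mul k A).compl₁₂ j j')
    (fun r x y => by
      have h1 := j_hom.actR (op r) x
      rw [𝒜.actR_eq] at h1
      have h2 := j'_left r y
      change j (𝓗.rR (op r) x) * j' y = j x * j' (y * 𝓗.right.t (op r))
      rw [h2, ← mul_assoc, ← h1]; rfl) (𝓗.right.Δ h) = ηL (𝓗.left.ε h)
  /-- `j'(h₁) j(h₂) = η_R(ε_R(h))` for the coproduct of the left bialgebroid -/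
  j'_mul_j : ∀ h, BT.lift ((LinearMap.mul k A).compl₁₂ j' j)
    (fun l x y => by
      change j' (𝓗.left.t (op l) * x) * j y = j' x * j (𝓗.left.s l * y)
      rw [j'_right, j_left, mul_assoc]) (𝓗.left.Δ h) = 𝒜.η (𝓗.right.ε h)

/-- `T ⊆ A` is an `𝓗`-cleft extension, where `T` is the algebra of coinvariants. -/
def IsCleft : Prop := Nonempty 𝒜.Cleaving

end ComoduleAlgebra

end ComoduleAlgebra

/-! ### The category of Hopf modules -/

section Transport

variable {k : Type*} [CommRing k] {B : Type*} [Ring B] [Algebra k B]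
  {C : Type*} [Ring C] [Algebra k C]
  {M : Type*} [AddCommGroup M] [Module k M] {M' : Type*} [AddCommGroup M'] [Module k M']
  {N : Type*} [AddCommGroup N] [Module k N] {P : Type*} [AddCommGroup P] [Module k P]
  {ι : Type*}

theorem Coassoc.of_maps {rB : RAct k B M} {rC : RAct k C M} {lN : LAct k B N} {rN : RAct k C N}
    {lP : LAct k C P} {comm : ∀ b (c : Cᵐᵒᵖ) n, lN b (rN c n) = rN c (lN b n)}
    {coB : M →ₗ[k] BT rB lN} {coC : M →ₗ[k] BT rC lP} {Δ : N →ₗ[k] BT rN lP}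
    (h : Coassoc rB rC lN rN lP comm coB coC Δ)
    {rB' : RAct k B M'} {rC' : RAct k C M'} {coB' : M' →ₗ[k] BT rB' lN} {coC' : M' →ₗ[k] BT rC' lP}
    (i : ι → M →ₗ[k] M')
    (hi : ∀ p : M' → Prop, (∀ w m, p (i w m)) → p 0 → (∀ x y, p x → p y → p (x + y)) → ∀ z, p z)
    (iB : ∀ w (b : Bᵐᵒᵖ) m, i w (rB b m) = rB' b (i w m))
    (iC : ∀ w (c : Cᵐᵒᵖ) m, i w (rC c m) = rC' c (i w m))
    (hB : ∀ w m, coB' (i w m) = BT.map (i w) LinearMap.id (iB w) (fun _ _ => rfl) (coB m))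
    (hC : ∀ w m, coC' (i w m) = BT.map (i w) LinearMap.id (iC w) (fun _ _ => rfl) (coC m)) :
    Coassoc rB' rC' lN rN lP comm coB' coC' Δ := by
  have hr : ∀ (c : Cᵐᵒᵖ) m, coB' (rC' c m) = BT.rightAct rB' lN rN comm c (coB' m) := by
    intro c m
    refine hi (fun m => coB' (rC' c m) = BT.rightAct rB' lN rN comm c (coB' m)) ?_ (by simp)
      (fun x y hx hy => by simp only [map_add, hx, hy]) m
    intro w m
    rw [← iC, hB, h.right_linear, hB]
    generalize coB m = z
    induction z using BT.induction with
    | hm m n => simp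
    | h0 => simp
    | ha x y hx hy => simp only [map_add, hx, hy]
  refine ⟨hr, h.left_linear, fun m => ?_⟩
  refine hi (fun m => BT.assoc rB' lN rN lP comm
      (BT.map coB' LinearMap.id hr (fun _ _ => rfl) (coC' m)) =
    BT.map LinearMap.id Δ (fun _ _ => rfl) h.left_linear (coB' m)) ?_ (by simp)
      (fun x y hx hy => by simp only [map_add, hx, hy]) m
  intro w m
  have key := congrArg (BT.map (ρ' := rB') (i w) LinearMap.id (iB w) (fun _ _ => rfl))
    (h.coassoc m)
  have h1 : ∀ z p, BT.insert rB' lN rN lP comm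
      (BT.map (i w) LinearMap.id (iB w) (fun _ _ => rfl) z) p =
      BT.map (i w) LinearMap.id (iB w) (fun _ _ => rfl) (BT.insert rB lN rN lP comm z p) := by
    intro z p
    induction z using BT.induction with
    | hm m n => simp
    | h0 => simp
    | ha x y hx hy => simp only [map_add, LinearMap.add_apply, hx, hy]
  have h2 : ∀ z, BT.assoc rB' lN rN lP comm (BT.map coB' LinearMap.id hr (fun _ _ => rfl)
      (BT.map (i w) LinearMap.id (iC w) (fun _ _ => rfl) z)) =
      BT.map (i w) LinearMap.id (iB w) (fun _ _ => rfl) (BT.assoc rB lN rN lP comm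
        (BT.map coB LinearMap.id h.right_linear (fun _ _ => rfl) z)) := by
    intro z
    induction z using BT.induction with
    | hm m n => simp [hB, h1]
    | h0 => simp
    | ha x y hx hy => simp only [map_add, hx, hy]
  have h3 : ∀ z, BT.map LinearMap.id Δ (fun _ _ => rfl) h.left_linear
      (BT.map (ρ' := rB') (σ' := lN) (i w) LinearMap.id (iB w) (fun _ _ => rfl) z) =
      BT.map (i w) LinearMap.id (iB w) (fun _ _ => rfl)
        (BT.map LinearMap.id Δ (fun _ _ => rfl) h.left_linear z) := by
    intro z
    induction z using BT.induction with
    | hm m n => simp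
    | h0 => simp
    | ha x y hx hy => simp only [map_add, hx, hy]
  rw [hB, hC, h2, h3]
  exact key

theorem IsComodule.of_maps {l : LAct k B N} {r : RAct k B N} {Δ : N →ₗ[k] BT r l}
    {ε : N →ₗ[k] B} {hN : IsCoring l r Δ ε} {rM : RAct k B M} {co : M →ₗ[k] BT rM l}
    (h : IsComodule hN rM co) {rM' : RAct k B M'} {co' : M' →ₗ[k] BT rM' l} (i : ι → M →ₗ[k] M')
    (hi : ∀ p : M' → Prop, (∀ w m, p (i w m)) → p 0 → (∀ x y, p x → p y → p (x + y)) → ∀ z, p z)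
    (iB : ∀ w (b : Bᵐᵒᵖ) m, i w (rM b m) = rM' b (i w m))
    (hB : ∀ w m, co' (i w m) = BT.map (i w) LinearMap.id (iB w) (fun _ _ => rfl) (co m)) :
    IsComodule hN rM' co' := by
  refine ⟨h.coassoc.of_maps i hi iB iB hB hB, fun m => ?_⟩
  refine hi (fun m => BT.contr rM' l ε hN.counit_left (co' m) = m) ?_ (by simp)
      (fun x y hx hy => by simp only [map_add, hx, hy]) m
  intro w m
  have h1 : ∀ z, BT.contr rM' l ε hN.counit_left
      (BT.map (i w) LinearMap.id (iB w) (fun _ _ => rfl) z) =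
      i w (BT.contr rM l ε hN.counit_left z) := by
    intro z
    induction z using BT.induction with
    | hm m n => simp [iB]
    | h0 => simp
    | ha x y hx hy => simp only [map_add, hx, hy]
  rw [hB, h1, h.counit]

/-- The bilinear map `(m, a) ↦ m a` of a right action. -/
def RAct.bil (act : RAct k B M) : M →ₗ[k] B →ₗ[k] M :=
  (act.toLinearMap ∘ₗ (opLinearEquiv k).toLinearMap).flip

@[simp] theorem RAct.bil_apply (act : RAct k B M) (m : M) (b : B) :
    act.bil m b = act (op b) m := (rfl)

end Transport

section HopfModule

variable {k : Type u₁} [CommRing k] {L : Type u₂} [Ring L] [Algebra k L] {R : Type u₃} [Ring R]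
  [Algebra k R] {H : Type u₄} [Ring H] [Algebra k H] {𝓗 : HopfAlgebroid k L R H}
  {A : Type u₅} [Ring A] [Algebra k A]

/-- A right `A`-module in the monoidal category of `𝓗`-comodules, i.e. an `𝓗`-comodule `M` with a
right `A`-action that induces a comodule map `M ⊗_R A → M`. -/
structure HopfModule (𝒜 : ComoduleAlgebra 𝓗 A) where
  /-- the underlying `k`-module -/
  carrier : Type v
  [addCommGroup : AddCommGroup carrier]
  [module : Module k carrier]
  /-- the `𝓗`-comodule structure -/
  com : HComodule 𝓗 carrier
  /-- the right `A`-action -/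
  act : RAct k A carrier
  isAction : com.IsAction 𝒜.com act.bil

attribute [instance] HopfModule.addCommGroup HopfModule.module

namespace HopfModule

variable {𝒜 : ComoduleAlgebra 𝓗 A}

/-- Morphisms are the right `A`-linear morphisms of `𝓗`-comodules. -/
@[ext] structure Hom (X Y : HopfModule.{v} 𝒜) where
  /-- the underlying map -/
  map : X.carrier →ₗ[k] Y.carrier
  map_act : ∀ (a : Aᵐᵒᵖ) m, map (X.act a m) = Y.act a (map m)
  isHom : X.com.IsHom Y.com map

end HopfModule

variable {M M' M'' : Type*} [AddCommGroup M] [Module k M] [AddCommGroup M'] [Module k M']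
  [AddCommGroup M''] [Module k M'']

theorem HComodule.IsHom.id (X : HComodule 𝓗 M) : X.IsHom X LinearMap.id where
  actR _ _ := rfl
  actL _ _ := rfl
  coR m := by
    rw [LinearMap.id_apply]
    generalize X.coR m = z
    induction z using BT.induction with
    | hm m n => simp
    | h0 => simp
    | ha x y hx hy => rw [map_add, ← hx, ← hy]
  coL m := by
    rw [LinearMap.id_apply]
    generalize X.coL m = z
    induction z using BT.induction with
    | hm m n => simp
    | h0 => simp
    | ha x y hx hy => rw [map_add, ← hx, ← hy]

theorem HComodule.IsHom.comp {X : HComodule 𝓗 M} {X' : HComodule 𝓗 M'} {X'' : HComodule 𝓗 M''}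
    {g : M' →ₗ[k] M''} {f : M →ₗ[k] M'} (hg : X'.IsHom X'' g) (hf : X.IsHom X' f) :
    X.IsHom X'' (g ∘ₗ f) where
  actR r m := by simp [hf.actR, hg.actR]
  actL l m := by simp [hf.actL, hg.actL]
  coR m := by
    rw [LinearMap.comp_apply, hg.coR, hf.coR]
    generalize X.coR m = z
    induction z using BT.induction with
    | hm m n => simp
    | h0 => simp
    | ha x y hx hy => simp only [map_add, hx, hy]
  coL m := by
    rw [LinearMap.comp_apply, hg.coL, hf.coL]
    generalize X.coL m = z
    induction z using BT.induction with
    | hm m n => simp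
    | h0 => simp
    | ha x y hx hy => simp only [map_add, hx, hy]

namespace HopfModule

variable {𝒜 : ComoduleAlgebra 𝓗 A}

instance category : Category (HopfModule.{v} 𝒜) where
  Hom := Hom
  id X := ⟨LinearMap.id, fun _ _ => rfl, .id _⟩
  comp f g := ⟨g.map ∘ₗ f.map, fun a m => by simp [f.map_act, g.map_act], g.isHom.comp f.isHom⟩

@[ext] theorem hom_ext {X Y : HopfModule.{v} 𝒜} {f g : X ⟶ Y} (h : ∀ m, f.map m = g.map m) :
    f = g :=
  Hom.ext (LinearMap.ext h)

@[simp] theorem id_map (X : HopfModule.{v} 𝒜) (m : X.carrier) : Hom.map (𝟙 X) m = m := (rfl)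

@[simp] theorem comp_map {X Y Z : HopfModule.{v} 𝒜} (f : X ⟶ Y) (g : Y ⟶ Z) (m : X.carrier) :
    Hom.map (f ≫ g) m = g.map (f.map m) := (rfl)

end HopfModule

theorem HComodule.IsAction.of_maps {A : Type*} [AddCommGroup A] [Module k A] {X : HComodule 𝓗 M}
    {Z : HComodule 𝓗 A} {mu : M →ₗ[k] A →ₗ[k] M} (h : X.IsAction Z mu) {X' : HComodule 𝓗 M'}
    {mu' : M' →ₗ[k] A →ₗ[k] M'} {ι : Type*} (i : ι → M →ₗ[k] M')
    (hi : ∀ p : M' → Prop, (∀ w m, p (i w m)) → p 0 → (∀ x y, p x → p y → p (x + y)) → ∀ z, p z)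
    (hom : ∀ w, X.IsHom X' (i w)) (hmu : ∀ w m a, mu' (i w m) a = i w (mu m a)) :
    X'.IsAction Z mu' := by
  have h1 : ∀ (r : R) m a,
      mu' (X'.actR (op r) m) a = mu' m (Z.actL (op (𝓗.left.ε (𝓗.right.s r))) a) := by
    intro r z a
    refine hi (fun z => mu' (X'.actR (op r) z) a =
      mu' z (Z.actL (op (𝓗.left.ε (𝓗.right.s r))) a)) ?_ (by simp)
      (fun x y hx hy => by simp only [map_add, LinearMap.add_apply, hx, hy]) z
    intro w m
    rw [← (hom w).actR, hmu, hmu, h.balanced]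
  have h2 : ∀ m (r : Rᵐᵒᵖ) a, mu' m (Z.actR r a) = X'.actR r (mu' m a) := by
    intro z r a
    refine hi (fun z => mu' z (Z.actR r a) = X'.actR r (mu' z a)) ?_ (by simp)
      (fun x y hx hy => by simp only [map_add, LinearMap.add_apply, hx, hy]) z
    intro w m
    rw [hmu, hmu, h.actR, (hom w).actR]
  have h3 : ∀ a (l : Lᵐᵒᵖ) m, mu' (X'.actL l m) a = X'.actL l (mu' m a) := by
    intro a l z
    refine hi (fun z => mu' (X'.actL l z) a = X'.actL l (mu' z a)) ?_ (by simp)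
      (fun x y hx hy => by simp only [map_add, LinearMap.add_apply, hx, hy]) z
    intro w m
    rw [← (hom w).actL, hmu, hmu, h.actL, (hom w).actL]
  refine ⟨h1, h2, h3, fun z a => ?_, fun z a => ?_⟩
  · refine hi (fun z => X'.coR (mu' z a) = BT.lift _ _ (X'.coR z)) ?_ (by simp)
      (fun x y hx hy => by simp only [map_add, LinearMap.add_apply, hx, hy]) z
    intro w m
    rw [hmu, (hom w).coR, (hom w).coR, h.coR]
    generalize X.coR m = u
    induction u using BT.induction with
    | hm x y =>
      rw [BT.lift_mk, BT.map_mk, BT.lift_mk]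
      generalize Z.coR a = v
      induction v using BT.induction with
      | hm m n => simp [hmu]
      | h0 => simp
      | ha x y hx hy => simp only [map_add, LinearMap.add_apply, hx, hy]
    | h0 => simp
    | ha x y hx hy => simp only [map_add, hx, hy]
  · have lin : ∀ (φ : M' →ₗ[k] A →ₗ[k] H →ₗ[k] BT X'.actL 𝓗.lL)
        (hφ : ∀ z (l : L) m n, φ z (Z.actL (op l) m) n = φ z m (𝓗.lL l n))
        (p : ∀ w m, X'.coL (mu' (i w m) a) = BT.lift (φ (i w m)) (hφ (i w m)) (Z.coL a)),
        X'.coL (mu' z a) = BT.lift (φ z) (hφ z) (Z.coL a) := by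
      intro φ hφ p
      have hadd : ∀ x y v, BT.lift (φ (x + y)) (hφ (x + y)) v =
          BT.lift (φ x) (hφ x) v + BT.lift (φ y) (hφ y) v := by
        intro x y v
        induction v using BT.induction with
        | hm m n => simp
        | h0 => simp
        | ha a b ha hb =>
          rw [(BT.lift (φ (x + y)) (hφ (x + y))).map_add, (BT.lift (φ x) (hφ x)).map_add,
            (BT.lift (φ y) (hφ y)).map_add, ha, hb]
          abel
      have hzero : ∀ v, BT.lift (φ 0) (hφ 0) v = 0 := by
        intro v
        induction v using BT.induction with
        | hm m n => simp
        | h0 => simp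
        | ha a b ha hb => simp only [map_add, ha, hb, add_zero]
      refine hi (fun z => X'.coL (mu' z a) = BT.lift (φ z) (hφ z) (Z.coL a)) p
        (by rw [hzero]; simp) (fun x y hx hy => ?_) z
      rw [hadd, ← hx, ← hy]
      simp
    refine lin (BT.bimap mu'.flip (mulFlip k H) (flip_act h3) (mulFlip_lmulL _) ∘ₗ X'.coL)
      (fun z l _ _ => BT.bimap_bal _ _ (flip_act h3) (mulFlip_lmulL _) (X'.takeuchiL l z)
        (fun _ => by simp [h1, 𝓗.ε_s_ε_t]) (fun _ => by simp [mul_assoc])) ?_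
    intro w m
    rw [hmu, (hom w).coL, h.coL]
    generalize Z.coL a = v
    induction v using BT.induction with
    | hm x y =>
      rw [BT.lift_mk, BT.lift_mk, LinearMap.comp_apply, (hom w).coL]
      generalize X.coL m = u
      induction u using BT.induction with
      | hm m n => simp [hmu]
      | h0 => simp
      | ha x y hx hy => simp only [map_add, LinearMap.add_apply, hx, hy]
    | h0 => simp
    | ha x y hx hy => simp only [map_add, hx, hy]

/-! ### The induction functor -/

namespace ComoduleAlgebra

variable (𝒜 : ComoduleAlgebra 𝓗 A) {B : Type*} [Ring B] [Algebra k B]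

theorem actR_coinv {a : A} (ha : a ∈ 𝒜.coinvariants) (l : L) :
    𝒜.com.actL (op l) a = 𝒜.com.actR (op (𝓗.right.ε (𝓗.left.t (op l)))) a := by
  have ha' : 𝒜.com.coR a = BT.mk _ _ a 1 := ha
  rw [← 𝒜.com.isComoduleR.counit (𝒜.com.actL (op l) a), 𝒜.com.coassocRL.right_linear, ha',
    BT.rightAct_mk, BT.contr_mk]
  simp

/-- Left multiplication by a coinvariant is a comodule endomorphism of `A`. -/
theorem mulLeft_isHom {b : A} (hb : b ∈ 𝒜.coinvariants) :
    𝒜.com.IsHom 𝒜.com (LinearMap.mulLeft k b) := by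
  have hb' : 𝒜.com.coR b = BT.mk _ _ b 1 := hb
  have hL := 𝒜.com.coinvL hb'
  have hl : ∀ (l : Lᵐᵒᵖ) m, b * 𝒜.com.actL l m = 𝒜.com.actL l (b * m) := fun l m => by
    have h1 := 𝒜.isAction.balanced (𝓗.right.ε (𝓗.left.t l)) b m
    have h2 := 𝒜.isAction.actL m l b
    have h3 := 𝒜.actR_coinv hb l.unop
    rw [op_unop] at h3
    rw [h3] at h2
    have h4 := 𝓗.ε_s_ε_t l.unop
    rw [op_unop] at h4
    rw [h4, op_unop, h2] at h1
    exact h1.symm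
  refine ⟨fun r m => ?_, fun l m => by simpa using hl l m, fun m => ?_, fun m => ?_⟩
  · simpa using 𝒜.isAction.actR b r m
  · refine (𝒜.isAction.coR b m).trans ?_
    rw [hb', BT.lift_mk]
    generalize 𝒜.com.coR m = z
    induction z using BT.induction with
    | hm m n => simp
    | h0 => simp
    | ha x y hx hy => simp only [map_add, LinearMap.add_apply, hx, hy]
  · refine (𝒜.isAction.coL b m).trans ?_
    generalize 𝒜.com.coL m = z
    induction z using BT.induction with
    | hm m n =>
      rw [BT.lift_mk, hL]
      exact (BT.bimap_mk _ _ _ _ _ _ _ _).trans (by simp)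
    | h0 => simp
    | ha x y hx hy => simp only [map_add, hx, hy]

variable (f : B →ₐ[k] A)

theorem lmulL_actR (hf : ∀ b, f b ∈ 𝒜.coinvariants) (b : B) (r : Rᵐᵒᵖ) (a : A) :
    lmulL f b (𝒜.com.actR r a) = 𝒜.com.actR r (lmulL f b a) := by
  simpa using (𝒜.mulLeft_isHom (hf b)).actR r a

theorem lmulL_actL (hf : ∀ b, f b ∈ 𝒜.coinvariants) (b : B) (l : Lᵐᵒᵖ) (a : A) :
    lmulL f b (𝒜.com.actL l a) = 𝒜.com.actL l (lmulL f b a) := by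
  simpa using (𝒜.mulLeft_isHom (hf b)).actL l a

variable (hf : ∀ b, f b ∈ 𝒜.coinvariants) {W : Type*} [AddCommGroup W] [Module k W]
  (ρ : RAct k B W)

/-- The right `R`-action on `W ⊗_B A`, given by that on the second factor. -/
def indActR : RAct k R (BT ρ (lmulL f)) :=
  BT.rightAct ρ (lmulL f) 𝒜.com.actR (𝒜.lmulL_actR f hf)

/-- The right `L`-action on `W ⊗_B A`, given by that on the second factor. -/
def indActL : RAct k L (BT ρ (lmulL f)) :=
  BT.rightAct ρ (lmulL f) 𝒜.com.actL (𝒜.lmulL_actL f hf)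

theorem indActR_mk (r : Rᵐᵒᵖ) (w : W) (a : A) : 𝒜.indActR f hf ρ r (BT.mk _ _ w a) =
    BT.mk _ _ w (𝒜.com.actR r a) :=
  BT.rightAct_mk _ _ r w a

theorem indActL_mk (r : Lᵐᵒᵖ) (w : W) (a : A) : 𝒜.indActL f hf ρ r (BT.mk _ _ w a) =
    BT.mk _ _ w (𝒜.com.actL r a) :=
  BT.rightAct_mk _ _ r w a

/-- The coaction `w ⊗ a ↦ (w ⊗ a⁰) ⊗_R a¹`. -/
def indCoR : BT ρ (lmulL f) →ₗ[k] BT (𝒜.indActR f hf ρ) 𝓗.lR :=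
  BT.lift ((BT.mapL (BT.mk ρ (lmulL f)) (fun w r a => (𝒜.indActR_mk f hf ρ r w a).symm) ∘ₗ
      𝒜.com.coR).flip) (fun b w a => by
    have h := (𝒜.mulLeft_isHom (hf b)).coR a
    rw [LinearMap.mulLeft_apply] at h
    simp only [LinearMap.flip_apply, LinearMap.comp_apply, lmulL_apply, h]
    generalize 𝒜.com.coR a = z
    induction z using BT.induction with
    | hm m n => simp [BT.mk_bal]
    | h0 => simp
    | ha x y hx hy => simp only [map_add, LinearMap.add_apply, hx, hy])

/-- The coaction `w ⊗ a ↦ (w ⊗ a₀) ⊗_L a₁`. -/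
def indCoL : BT ρ (lmulL f) →ₗ[k] BT (𝒜.indActL f hf ρ) 𝓗.lL :=
  BT.lift ((BT.mapL (BT.mk ρ (lmulL f)) (fun w r a => (𝒜.indActL_mk f hf ρ r w a).symm) ∘ₗ
      𝒜.com.coL).flip) (fun b w a => by
    have h := (𝒜.mulLeft_isHom (hf b)).coL a
    rw [LinearMap.mulLeft_apply] at h
    simp only [LinearMap.flip_apply, LinearMap.comp_apply, lmulL_apply, h]
    generalize 𝒜.com.coL a = z
    induction z using BT.induction with
    | hm m n => simp [BT.mk_bal]
    | h0 => simp
    | ha x y hx hy => simp only [map_add, LinearMap.add_apply, hx, hy])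

theorem indCoR_mk (w : W) (a : A) : 𝒜.indCoR f hf ρ (BT.mk _ _ w a) =
    BT.map (BT.mk ρ (lmulL f) w) LinearMap.id (fun r a => (𝒜.indActR_mk f hf ρ r w a).symm)
      (fun _ _ => rfl) (𝒜.com.coR a) := by
  simp [indCoR]

theorem indCoL_mk (w : W) (a : A) : 𝒜.indCoL f hf ρ (BT.mk _ _ w a) =
    BT.map (BT.mk ρ (lmulL f) w) LinearMap.id (fun r a => (𝒜.indActL_mk f hf ρ r w a).symm)
      (fun _ _ => rfl) (𝒜.com.coL a) := by
  simp [indCoL]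

/-- The comodule `W ⊗_B A`, with the actions and coactions of the second factor, for a right
`B`-module `W` and an algebra map `f` from `B` to the coinvariants of `A`. -/
def inducedComodule : HComodule 𝓗 (BT ρ (lmulL f)) where
  actR := 𝒜.indActR f hf ρ
  actL := 𝒜.indActL f hf ρ
  coR := 𝒜.indCoR f hf ρ
  coL := 𝒜.indCoL f hf ρ
  isComoduleR := 𝒜.com.isComoduleR.of_maps (BT.mk ρ (lmulL f))
    (fun _ h h0 ha z => BT.induction z h h0 ha) _ (𝒜.indCoR_mk f hf ρ)
  isComoduleL := 𝒜.com.isComoduleL.of_maps (BT.mk ρ (lmulL f))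
    (fun _ h h0 ha z => BT.induction z h h0 ha) _ (𝒜.indCoL_mk f hf ρ)
  coassocRL := 𝒜.com.coassocRL.of_maps (BT.mk ρ (lmulL f))
    (fun _ h h0 ha z => BT.induction z h h0 ha) _ _ (𝒜.indCoR_mk f hf ρ) (𝒜.indCoL_mk f hf ρ)
  coassocLR := 𝒜.com.coassocLR.of_maps (BT.mk ρ (lmulL f))
    (fun _ h h0 ha z => BT.induction z h h0 ha) _ _ (𝒜.indCoL_mk f hf ρ) (𝒜.indCoR_mk f hf ρ)

/-- The right `A`-action `(w ⊗ a) a' = w ⊗ a a'` on `W ⊗_B A`. -/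
def inducedAct : RAct k A (BT ρ (lmulL f)) :=
  BT.rightAct ρ (lmulL f) (rmulR (AlgHom.id k A)) (lmulL_rmulR_comm f (AlgHom.id k A))

theorem inducedAct_mk (w : W) (a a' : A) :
    inducedAct f ρ (op a') (BT.mk _ _ w a) = BT.mk _ _ w (a * a') :=
  BT.rightAct_mk _ _ (op a') w a

theorem mk_isHom (w : W) :
    𝒜.com.IsHom (𝒜.inducedComodule f hf ρ) (BT.mk ρ (lmulL f) w) :=
  ⟨fun r a => (𝒜.indActR_mk f hf ρ r w a).symm, fun l a => (𝒜.indActL_mk f hf ρ l w a).symm,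
    𝒜.indCoR_mk f hf ρ w, 𝒜.indCoL_mk f hf ρ w⟩

theorem induced_isAction :
    (𝒜.inducedComodule f hf ρ).IsAction 𝒜.com (inducedAct f ρ).bil :=
  𝒜.isAction.of_maps (BT.mk ρ (lmulL f)) (fun _ h h0 ha z => BT.induction z h h0 ha)
    (𝒜.mk_isHom f hf ρ) (fun w a a' => inducedAct_mk f ρ w a a')

/-- Scalars of `k` on a right module over the `k`-algebra `B`. -/
@[reducible] def moduleCatModule (W : ModuleCat.{v} Bᵐᵒᵖ) : Module k W :=
  Module.restrictScalars k Bᵐᵒᵖ W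

attribute [local instance] moduleCatModule

/-- The right `B`-module `W` as an explicit action. -/
def modAct (W : ModuleCat.{v} Bᵐᵒᵖ) : RAct k B W :=
  haveI : IsScalarTower k Bᵐᵒᵖ W := IsScalarTower.restrictScalars k Bᵐᵒᵖ W
  Algebra.lsmul k k W

theorem modAct_apply (W : ModuleCat.{v} Bᵐᵒᵖ) (b : Bᵐᵒᵖ) (w : W) :
    modAct (k := k) W b w = b • w := (rfl)

/-- The `k`-linear map underlying a map of right `B`-modules. -/
def modMap {W W' : ModuleCat.{v} Bᵐᵒᵖ} (g : W ⟶ W') : W →ₗ[k] W' where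
  toFun := g
  map_add' := map_add g.hom
  map_smul' c w := g.hom.map_smul (algebraMap k Bᵐᵒᵖ c) w

theorem modMap_apply {W W' : ModuleCat.{v} Bᵐᵒᵖ} (g : W ⟶ W') (w : W) :
    modMap (k := k) g w = g w := (rfl)

theorem modMap_act {W W' : ModuleCat.{v} Bᵐᵒᵖ} (g : W ⟶ W') (b : Bᵐᵒᵖ) (w : W) :
    modMap (k := k) g (modAct (k := k) W b w) = modAct (k := k) W' b (modMap (k := k) g w) :=
  g.hom.map_smul b w

/-- The map `g ⊗_B A`. -/
def indMap {W W' : ModuleCat.{v} Bᵐᵒᵖ} (g : W ⟶ W') :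
    BT (modAct (k := k) W) (lmulL f) →ₗ[k] BT (modAct (k := k) W') (lmulL f) :=
  BT.map (modMap g) LinearMap.id (modMap_act g) (fun _ _ => rfl)

theorem indMap_mk {W W' : ModuleCat.{v} Bᵐᵒᵖ} (g : W ⟶ W') (w : W) (a : A) :
    indMap f g (BT.mk _ _ w a) = BT.mk _ _ (modMap (k := k) g w) a :=
  BT.map_mk _ _ _ _ w a

theorem indMap_isHom {W W' : ModuleCat.{v} Bᵐᵒᵖ} (g : W ⟶ W') :
    (𝒜.inducedComodule f hf (modAct W)).IsHom (𝒜.inducedComodule f hf (modAct W'))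
      (indMap f g) := by
  have h := fun w => 𝒜.mk_isHom f hf (modAct (k := k) W) w
  have h' := fun w => 𝒜.mk_isHom f hf (modAct (k := k) W') w
  refine ⟨fun r z => ?_, fun l z => ?_, fun z => ?_, fun z => ?_⟩
  · induction z using BT.induction with
    | hm w a => rw [← (h w).actR, indMap_mk, indMap_mk, ← (h' _).actR]
    | h0 => simp
    | ha x y hx hy => simp only [map_add, hx, hy]
  · induction z using BT.induction with
    | hm w a => rw [← (h w).actL, indMap_mk, indMap_mk, ← (h' _).actL]
    | h0 => simp
    | ha x y hx hy => simp only [map_add, hx, hy]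
  · induction z using BT.induction with
    | hm w a =>
      rw [indMap_mk, (h w).coR, (h' _).coR]
      generalize 𝒜.com.coR a = v
      induction v using BT.induction with
      | hm m n => simp [indMap_mk]
      | h0 => simp
      | ha x y hx hy => simp only [map_add, hx, hy]
    | h0 => simp
    | ha x y hx hy => simp only [map_add, hx, hy]
  · induction z using BT.induction with
    | hm w a =>
      rw [indMap_mk, (h w).coL, (h' _).coL]
      generalize 𝒜.com.coL a = v
      induction v using BT.induction with
      | hm m n => simp [indMap_mk]
      | h0 => simp
      | ha x y hx hy => simp only [map_add, hx, hy]
    | h0 => simp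
    | ha x y hx hy => simp only [map_add, hx, hy]

/-- The functor `- ⊗_B A` from right `B`-modules to Hopf modules, for an algebra map `f` from `B` to
the coinvariants of `A`. -/
def inducedFunctor : ModuleCat.{max v u₅} Bᵐᵒᵖ ⥤ HopfModule.{max v u₅} 𝒜 where
  obj W :=
    { carrier := BT (modAct (k := k) W) (lmulL f)
      com := 𝒜.inducedComodule f hf (modAct W)
      act := inducedAct f (modAct W)
      isAction := 𝒜.induced_isAction f hf (modAct W) }
  map {W W'} g :=
    { map := indMap f g
      map_act := fun a z => by
        induction z using BT.induction with
        | hm w x =>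
          induction a
          rw [inducedAct_mk, indMap_mk, indMap_mk, inducedAct_mk]
        | h0 => simp
        | ha x y hx hy => simp only [map_add, hx, hy]
      isHom := 𝒜.indMap_isHom f hf g }
  map_id W := HopfModule.Hom.ext (BT.hom_ext fun w a => indMap_mk f (𝟙 W) w a)
  map_comp {W W' W''} g g' := HopfModule.Hom.ext (BT.hom_ext fun w a => by
    refine (indMap_mk f (g ≫ g') w a).trans (Eq.symm ?_)
    refine (congrArg (indMap f g') (indMap_mk f g w a)).trans ?_
    rw [indMap_mk]
    rfl)

/-- The functor `- ⊗_T A : M_T → M^𝓗_A`, where `T` is the algebra of coinvariants of `A`. -/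
def tensorFunctor : ModuleCat.{max v u₅} 𝒜.coinvariantsᵐᵒᵖ ⥤ HopfModule.{max v u₅} 𝒜 :=
  𝒜.inducedFunctor 𝒜.coinvariants.val (fun t => t.2)

end ComoduleAlgebra

theorem HopfAlgebroid.s_left_mem (𝓗 : HopfAlgebroid k L R H) (l : L) :
    𝓗.left.s l ∈ 𝓗.regular.coinvariants := by
  have h := 𝓗.coassoc_left_right.left_linear l 1
  rw [𝓗.right.Δ_one, BT.leftAct_mk, lmulL_apply, mul_one] at h
  exact h

/-- The functor `- ⊗_L H : M_L → M^𝓗_H`, where `H` is a left `L`-module by `l h = s_L(l) h`. -/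
def HopfAlgebroid.tensorFunctor (𝓗 : HopfAlgebroid k L R H) :
    ModuleCat.{max v u₄} Lᵐᵒᵖ ⥤ HopfModule.{max v u₄} 𝓗.regular :=
  𝓗.regular.inducedFunctor 𝓗.left.s 𝓗.s_left_mem

end HopfModule

end HopfAlgd

/-!
For a Hopf module `X` over a cleft comodule algebra `A`, the map `E(m) = m⁰ j'(m¹)` is a projection
of `X` onto its coinvariants. To see that `E(m)` is coinvariant without purity, compare the two maps
`m ↦ E(m)⁰ ⊗ E(m)¹` and `m ↦ E(m) ⊗ 1` from `X` to `X ⊗_R H`, on which `A` acts diagonally: both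
become the coaction of `X` after convolution with `j`, because `E(m₀) j(m₁) = m`, and `j` is
convolution invertible. The argument never leaves maps out of balanced tensor products, along which
coassociativity can be evaluated without any purity.

Induction along an isomorphism from `B` to the coinvariants of `A` is left adjoint to taking
coinvariants. The counit `n ⊗ a ↦ n a` has the inverse `m ↦ E(m₀) ⊗ j(m₁)`, and the unit
`w ↦ w ⊗ 1` is bijective because `a ↦ E(a) j(1)` is a `B`-linear retraction of `A` onto `B`.
The algebra `H` is cleft over `L` with `j = id` and `j' = S`.
-/

namespace HopfAlgd

section Convolution

variable {k : Type*} [CommRing k] {A : Type*} [Ring A] [Algebra k A]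
  {B : Type*} [Ring B] [Algebra k B] {C : Type*} [Ring C] [Algebra k C]
  {M : Type*} [AddCommGroup M] [Module k M] {N : Type*} [AddCommGroup N] [Module k N]
  {P : Type*} [AddCommGroup P] [Module k P] {V : Type*} [AddCommGroup V] [Module k V]
  {M' : Type*} [AddCommGroup M'] [Module k M'] {V' : Type*} [AddCommGroup V'] [Module k V']
  {rB : RAct k B M} {rC : RAct k C M} {lN : LAct k B N} {rN : RAct k C N} {lP : LAct k C P}

/-- Here `F` and `G` are two curried forms of one map out of `M ⊗_B N ⊗_C P`, and the statement is
coassociativity followed by that map. -/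
theorem Coassoc.lift_eq {comm : ∀ b (c : Cᵐᵒᵖ) n, lN b (rN c n) = rN c (lN b n)}
    {coB : M →ₗ[k] BT rB lN} {coC : M →ₗ[k] BT rC lP} {Δ : N →ₗ[k] BT rN lP}
    (h : Coassoc rB rC lN rN lP comm coB coC Δ)
    {F : BT rB lN →ₗ[k] P →ₗ[k] V} {G : M →ₗ[k] BT rN lP →ₗ[k] V}
    (hFG : ∀ m n p, F (BT.mk rB lN m n) p = G m (BT.mk rN lP n p))
    {f : BT rC lP →ₗ[k] V} (hf : ∀ m p, f (BT.mk rC lP m p) = F (coB m) p)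
    {g : BT rB lN →ₗ[k] V} (hg : ∀ m n, g (BT.mk rB lN m n) = G m (Δ n)) (m : M) :
    f (coC m) = g (coB m) := by
  have balanced (b : B) (m : M) (z : BT rN lP) :
      G (rB (op b) m) z = G m (BT.leftAct rN lP lN comm b z) :=
    LinearMap.congr_fun (g := G m ∘ₗ BT.leftAct rN lP lN comm b)
      (BT.hom_ext fun n p => by simp [← hFG, BT.mk_bal]) z
  let U : BT rB (BT.leftAct rN lP lN comm) →ₗ[k] V := BT.lift G balanced
  have U_insert (p : P) : U ∘ₗ (BT.insert rB lN rN lP comm).flip p = F.flip p :=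
    BT.hom_ext fun m n => by simp [U, hFG]
  have U_assoc : U ∘ₗ BT.assoc rB lN rN lP comm ∘ₗ
      BT.map coB LinearMap.id h.right_linear (fun _ _ => rfl) = f :=
    BT.hom_ext fun m p => by
      simpa [hf] using LinearMap.congr_fun (U_insert p) (coB m)
  have U_map : U ∘ₗ BT.map LinearMap.id Δ (fun _ _ => rfl) h.left_linear = g :=
    BT.hom_ext fun m n => by simp [U, hg]
  rw [← U_assoc, ← U_map]
  exact congrArg U (h.coassoc m)

/-- The map `m ⊗_B n ↦ Φ(m) φ(n)` into a right `A`-module, for a `B`-ring `A`. -/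
def BT.liftAct (act : RAct k A V) {η : B →ₐ[k] A} {Φ : M →ₗ[k] V} {φ : N →ₗ[k] A}
    (hΦ : ∀ b m, Φ (rB (op b) m) = act (op (η b)) (Φ m)) (hφ : ∀ b n, φ (lN b n) = η b * φ n) :
    BT rB lN →ₗ[k] V :=
  BT.lift (act.bil.compl₁₂ Φ φ) (fun b m n => by simp [hΦ, hφ])

section LiftAct

variable {act : RAct k A V} {η : B →ₐ[k] A} {Φ : M →ₗ[k] V} {φ : N →ₗ[k] A}
  (hΦ : ∀ b m, Φ (rB (op b) m) = act (op (η b)) (Φ m)) (hφ : ∀ b n, φ (lN b n) = η b * φ n)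

@[simp] theorem BT.liftAct_mk (m : M) (n : N) :
    BT.liftAct act hΦ hφ (BT.mk rB lN m n) = act (op (φ n)) (Φ m) :=
  BT.lift_mk _ _ m n

theorem BT.liftAct_rightAct {comm : ∀ b (c : Cᵐᵒᵖ) n, lN b (rN c n) = rN c (lN b n)}
    {ηC : C →ₐ[k] A} (hφr : ∀ c n, φ (rN (op c) n) = φ n * ηC c) (c : C) (z : BT rB lN) :
    BT.liftAct act hΦ hφ (BT.rightAct rB lN rN comm (op c) z) =
      act (op (ηC c)) (BT.liftAct act hΦ hφ z) :=
  LinearMap.congr_fun (f := BT.liftAct act hΦ hφ ∘ₗ BT.rightAct rB lN rN comm (op c))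
    (g := act (op (ηC c)) ∘ₗ BT.liftAct act hΦ hφ) (BT.hom_ext fun m n => by simp [hφr]) z

theorem BT.liftAct_leftAct {lM : LAct k C M}
    {comm : ∀ c (b : Bᵐᵒᵖ) m, lM c (rB b m) = rB b (lM c m)}
    {Φ : M →ₗ[k] A} {hΦ : ∀ b m, Φ (rB (op b) m) = rmulR (AlgHom.id k A) (op (η b)) (Φ m)}
    {ηC : C →ₐ[k] A} (hΦl : ∀ c m, Φ (lM c m) = ηC c * Φ m) (c : C) (z : BT rB lN) :
    BT.liftAct (rmulR (AlgHom.id k A)) hΦ hφ (BT.leftAct rB lN lM comm c z) =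
      ηC c * BT.liftAct (rmulR (AlgHom.id k A)) hΦ hφ z :=
  LinearMap.congr_fun
    (f := BT.liftAct (rmulR (AlgHom.id k A)) hΦ hφ ∘ₗ BT.leftAct rB lN lM comm c)
    (g := LinearMap.mulLeft k (ηC c) ∘ₗ BT.liftAct (rmulR (AlgHom.id k A)) hΦ hφ)
    (BT.hom_ext fun m n => by simp [hΦl, mul_assoc]) z

/-- The convolution product `m ↦ Φ(m₀) φ(m₁)` with respect to a coaction `m ↦ m₀ ⊗_B m₁`. -/
def convolution (co : M →ₗ[k] BT rB lN)
    (hΦ : ∀ b m, Φ (rB (op b) m) = act (op (η b)) (Φ m)) (hφ : ∀ b n, φ (lN b n) = η b * φ n) :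
    M →ₗ[k] V :=
  BT.liftAct act hΦ hφ ∘ₗ co

theorem convolution_apply (co : M →ₗ[k] BT rB lN) (m : M) :
    convolution co hΦ hφ m = BT.liftAct act hΦ hφ (co m) := rfl

theorem map_convolution {act' : RAct k A V'} {g : V →ₗ[k] V'}
    (hg : ∀ a v, g (act (op a) v) = act' (op a) (g v)) (co : M →ₗ[k] BT rB lN) (m : M) :
    g (convolution co hΦ hφ m) =
      convolution (act := act') (Φ := g ∘ₗ Φ) co (fun b m => by simp [hΦ, hg]) hφ m :=
  LinearMap.congr_fun (f := g ∘ₗ BT.liftAct act hΦ hφ)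
    (g := BT.liftAct act' (Φ := g ∘ₗ Φ) (fun b m => by simp [hΦ, hg]) hφ)
    (BT.hom_ext fun m n => by simp [hg]) (co m)

theorem convolution_comp {rB' : RAct k B M'} {co : M →ₗ[k] BT rB lN} {co' : M' →ₗ[k] BT rB' lN}
    {g : M' →ₗ[k] M} {hg : ∀ (b : Bᵐᵒᵖ) m, g (rB' b m) = rB b (g m)}
    (hco : ∀ m, co (g m) = BT.map g LinearMap.id hg (fun _ _ => rfl) (co' m)) (m : M') :
    convolution co hΦ hφ (g m) =
      convolution (act := act) (Φ := Φ ∘ₗ g) co' (fun b m => by simp [hg, hΦ]) hφ m := by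
  rw [convolution_apply, hco]
  exact LinearMap.congr_fun
    (f := BT.liftAct act hΦ hφ ∘ₗ BT.map g LinearMap.id hg (fun _ _ => rfl))
    (g := BT.liftAct act (Φ := Φ ∘ₗ g) (fun b m => by simp [hg, hΦ]) hφ)
    (BT.hom_ext fun m n => by simp) (co' m)

theorem convolution_congr {Φ' : M →ₗ[k] V}
    (hΦ' : ∀ b m, Φ' (rB (op b) m) = act (op (η b)) (Φ' m)) (co : M →ₗ[k] BT rB lN)
    (h : ∀ m, Φ m = Φ' m) (m : M) : convolution co hΦ hφ m = convolution co hΦ' hφ m := by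
  obtain rfl := LinearMap.ext h
  rfl

theorem convolution_counit {co : M →ₗ[k] BT rB lN} {ε : N →ₗ[k] B}
    {hε : ∀ b n, ε (lN b n) = b * ε n} (counit : ∀ m, BT.contr rB lN ε hε (co m) = m)
    (hφε : ∀ n, φ n = η (ε n)) (m : M) : convolution co hΦ hφ m = Φ m :=
  calc convolution co hΦ hφ m = Φ (BT.contr rB lN ε hε (co m)) :=
        LinearMap.congr_fun (f := BT.liftAct act hΦ hφ) (g := Φ ∘ₗ BT.contr rB lN ε hε)
          (BT.hom_ext fun m n => by simp [hΦ, hφε]) (co m)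
    _ = Φ m := by rw [counit]

end LiftAct

namespace Coassoc

variable {comm : ∀ b (c : Cᵐᵒᵖ) n, lN b (rN c n) = rN c (lN b n)}
  {coB : M →ₗ[k] BT rB lN} {coC : M →ₗ[k] BT rC lP} {Δ : N →ₗ[k] BT rN lP}
  (h : Coassoc rB rC lN rN lP comm coB coC Δ)
  {act : RAct k A V} {ηB : B →ₐ[k] A} {ηC : C →ₐ[k] A}
  {Φ Φ' : M →ₗ[k] V} {φ : N →ₗ[k] A} {χ : P →ₗ[k] A}
  (hΦ : ∀ b m, Φ (rB (op b) m) = act (op (ηB b)) (Φ m))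
  (hΦ' : ∀ b m, Φ' (rB (op b) m) = act (op (ηB b)) (Φ' m))
  (hφ : ∀ b n, φ (lN b n) = ηB b * φ n) (hφr : ∀ c n, φ (rN (op c) n) = φ n * ηC c)
  (hχ : ∀ c p, χ (lP c p) = ηC c * χ p)

include h hφr in
theorem convolution_right_linear (c : C) (m : M) :
    convolution coB hΦ hφ (rC (op c) m) = act (op (ηC c)) (convolution coB hΦ hφ m) := by
  rw [convolution_apply, h.right_linear, BT.liftAct_rightAct hΦ hφ hφr, convolution_apply]

include h hφ in
theorem convolution_left_linear (b : B) (n : N) :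
    convolution (act := rmulR (AlgHom.id k A)) Δ (by simpa using hφr) hχ (lN b n) =
      ηB b * convolution (act := rmulR (AlgHom.id k A)) Δ (by simpa using hφr) hχ n := by
  rw [convolution_apply, h.left_linear, BT.liftAct_leftAct hχ hφ, convolution_apply]

theorem convolution_assoc (m : M) :
    convolution coC (h.convolution_right_linear hΦ hφ hφr) hχ m =
      convolution (φ := convolution (act := rmulR (AlgHom.id k A)) Δ (by simpa using hφr) hχ) coB hΦ
        (h.convolution_left_linear hφ hφr hχ) m :=
  h.lift_eq (F := act.bil.compl₁₂ (BT.liftAct act hΦ hφ) χ)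
    (G := act.bil.compl₁₂ Φ (BT.liftAct (rmulR (AlgHom.id k A)) (by simpa using hφr) hχ))
    (fun m n p => by simp)
    (f := BT.liftAct act (h.convolution_right_linear hΦ hφ hφr) hχ)
    (g := BT.liftAct act hΦ (h.convolution_left_linear hφ hφr hχ))
    (fun m p => by simp [convolution_apply])
    (fun m n => by simp [convolution_apply]) m

variable {ε : N →ₗ[k] B} {hε : ∀ b n, ε (lN b n) = b * ε n}
  (counit : ∀ m, BT.contr rB lN ε hε (coB m) = m)
  (inv : ∀ n, convolution (act := rmulR (AlgHom.id k A)) Δ (by simpa using hφr) hχ n = ηB (ε n))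

include counit inv in
theorem convolution_cancel (m : M) :
    convolution coC (h.convolution_right_linear hΦ hφ hφr) hχ m = Φ m :=
  (h.convolution_assoc hΦ hφ hφr hχ m).trans (convolution_counit hΦ _ counit inv m)

include h counit inv in
theorem convolution_right_injective
    (heq : ∀ m, convolution coB hΦ hφ m = convolution coB hΦ' hφ m) : Φ = Φ' := by
  ext m
  rw [← h.convolution_cancel hΦ hφ hφr hχ counit inv,
    ← h.convolution_cancel hΦ' hφ hφr hχ counit inv]
  simp only [show convolution coB hΦ hφ = convolution coB hΦ' hφ from LinearMap.ext heq]

end Coassoc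

end Convolution

section HopfModules

variable {k : Type*} [CommRing k] {L : Type*} [Ring L] [Algebra k L] {R : Type*} [Ring R]
  [Algebra k R] {H : Type*} [Ring H] [Algebra k H] {𝓗 : HopfAlgebroid k L R H}
  {A : Type*} [Ring A] [Algebra k A] {𝒜 : ComoduleAlgebra 𝓗 A}
  {M : Type*} [AddCommGroup M] [Module k M] {M' : Type*} [AddCommGroup M'] [Module k M']

namespace HComodule

/-- The coinvariants `{m | m⁰ ⊗_R m¹ = m ⊗_R 1}` of an `𝓗`-comodule. -/
def coinv (X : HComodule 𝓗 M) : Submodule k M :=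
  LinearMap.eqLocus X.coR ((BT.mk X.actR 𝓗.lR).flip 1)

theorem mem_coinv {X : HComodule 𝓗 M} {m : M} : m ∈ X.coinv ↔ X.coR m = BT.mk _ _ m 1 := Iff.rfl

theorem IsHom.map_mem_coinv {X : HComodule 𝓗 M} {X' : HComodule 𝓗 M'} {f : M →ₗ[k] M'}
    (hf : X.IsHom X' f) {m : M} (hm : m ∈ X.coinv) : f m ∈ X'.coinv := by
  rw [mem_coinv, hf.coR, mem_coinv.1 hm, BT.map_mk, LinearMap.id_apply]

theorem actL_of_mem_coinv {X : HComodule 𝓗 M} {m : M} (hm : m ∈ X.coinv) (l : Lᵐᵒᵖ) :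
    X.actL l m = X.actR (op (𝓗.right.ε (𝓗.left.t l))) m := by
  rw [← X.isComoduleR.counit (X.actL l m), X.coassocRL.right_linear, mem_coinv.1 hm,
    BT.rightAct_mk, BT.contr_mk]
  simp

end HComodule

/-- The comodule algebra `A` as a module over itself. -/
abbrev ComoduleAlgebra.self (𝒜 : ComoduleAlgebra 𝓗 A) : HopfModule 𝒜 where
  carrier := A
  com := 𝒜.com
  act := rmulR (AlgHom.id k A)
  isAction := 𝒜.isAction

namespace HopfModule

variable {X : HopfModule 𝒜}

theorem isHom_of_mem_coinv {n : X.carrier} (hn : n ∈ X.com.coinv) :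
    𝒜.com.IsHom X.com (X.act.bil n) where
  actR r a := X.isAction.actR n r a
  actL l a := by
    have h := X.isAction.balanced (𝓗.right.ε (𝓗.left.t l)) n a
    rw [← HComodule.actL_of_mem_coinv hn, X.isAction.actL] at h
    induction l
    rw [𝓗.ε_s_ε_t] at h
    exact h.symm
  coR a := by
    rw [X.isAction.coR, HComodule.mem_coinv.1 hn, BT.lift_mk, BT.bimap_apply]
    exact LinearMap.congr_fun (BT.hom_ext fun b h => by simp) (𝒜.com.coR a)
  coL a := by
    refine (X.isAction.coL n a).trans (LinearMap.congr_fun (BT.hom_ext fun b h => ?_) (𝒜.com.coL a))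
    rw [BT.lift_mk, X.com.coinvL (HComodule.mem_coinv.1 hn)]
    simp

theorem act_mem_coinv {n : X.carrier} (hn : n ∈ X.com.coinv) {a : A} (ha : a ∈ 𝒜.coinvariants) :
    X.act (op a) n ∈ X.com.coinv :=
  (isHom_of_mem_coinv hn).map_mem_coinv ha

variable (X)

theorem actR_eq (r : R) (m : X.carrier) : X.com.actR (op r) m = X.act (op (𝒜.η r)) m := by
  simpa [𝒜.actL_eq] using X.isAction.balanced r m 1

/-- The map `m ⊗ h ↦ m a⁰ ⊗ h a¹` on `M ⊗_R H`, as a linear function of `a`. -/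
def diag : A →ₗ[k] Module.End k (BT X.com.actR 𝓗.lR) where
  toFun a := BT.lift (BT.bimap X.act.bil (LinearMap.mul k H) X.isAction.actR (mul_rmulL _)
    (𝒜.com.coR a)) (fun r m _ => BT.bimap_bal _ _ _ _ (𝒜.com.takeuchiR _ a)
      (X.isAction.balanced r m) (fun _ => by simp [mul_assoc, 𝓗.ε_t_ε_s]))
  map_add' _ _ := BT.hom_ext fun _ _ => by simp
  map_smul' _ _ := BT.hom_ext fun _ _ => by simp

/-- The map `a ⊗ x ↦ m a ⊗ h x`. -/
def orbitMap (m : X.carrier) (h : H) : BT 𝒜.com.actR 𝓗.lR →ₗ[k] BT X.com.actR 𝓗.lR :=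
  BT.map (X.act.bil m) (LinearMap.mul k H h) (X.isAction.actR m) (mul_rmulL _ h)

@[simp] theorem orbitMap_mk (m : X.carrier) (h x : H) (a : A) :
    X.orbitMap m h (BT.mk _ _ a x) = BT.mk _ _ (X.act (op a) m) (h * x) :=
  BT.map_mk _ _ _ _ a x

theorem diag_mk (a : A) (m : X.carrier) (h : H) :
    X.diag a (BT.mk _ _ m h) = X.orbitMap m h (𝒜.com.coR a) := by
  simp only [diag, orbitMap, LinearMap.coe_mk, AddHom.coe_mk, BT.lift_mk, BT.bimap_apply]

theorem coR_act (a : A) (m : X.carrier) : X.com.coR (X.act (op a) m) = X.diag a (X.com.coR m) :=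
  X.isAction.coR m a

theorem diag_one : X.diag 1 = 1 :=
  BT.hom_ext fun m h => by simp [diag_mk, 𝒜.coR_one]

theorem orbitMap_orbitMap (m : X.carrier) (h x : H) (a : A) (z : BT 𝒜.com.actR 𝓗.lR) :
    X.orbitMap m h (𝒜.self.orbitMap a x z) = X.orbitMap (X.act (op a) m) (h * x) z :=
  LinearMap.congr_fun (f := X.orbitMap m h ∘ₗ 𝒜.self.orbitMap a x)
    (BT.hom_ext fun b y => by simp [𝒜.self.orbitMap_mk a x y b, mul_assoc]) z

theorem diag_orbitMap (a : A) (m : X.carrier) (h : H) (z : BT 𝒜.com.actR 𝓗.lR) :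
    X.diag a (X.orbitMap m h z) = X.orbitMap m h (𝒜.self.diag a z) :=
  LinearMap.congr_fun (f := X.diag a ∘ₗ X.orbitMap m h) (g := X.orbitMap m h ∘ₗ 𝒜.self.diag a)
    (BT.hom_ext fun b x => by
      simpa [diag_mk, 𝒜.self.diag_mk] using
        (X.orbitMap_orbitMap m h x b (𝒜.com.coR a)).symm) z

theorem diag_mul (a b : A) : X.diag (a * b) = X.diag b * X.diag a :=
  BT.hom_ext fun m h => by
    rw [Module.End.mul_apply, diag_mk, diag_mk, diag_orbitMap, ← coR_act]
    rfl

/-- The diagonal right `A`-action `(m ⊗ h) a = m a⁰ ⊗ h a¹` on `M ⊗_R H`. -/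
def diagAct : RAct k A (BT X.com.actR 𝓗.lR) :=
  AlgHom.ofLinearMap (X.diag ∘ₗ (opLinearEquiv k).symm.toLinearMap) X.diag_one
    (fun a b => X.diag_mul b.unop a.unop)

theorem diagAct_op (a : A) : X.diagAct (op a) = X.diag a := rfl

end HopfModule

end HopfModules

section Projection

variable {k : Type*} [CommRing k] {L : Type*} [Ring L] [Algebra k L] {R : Type*} [Ring R]
  [Algebra k R] {H : Type*} [Ring H] [Algebra k H] {𝓗 : HopfAlgebroid k L R H}
  {A : Type*} [Ring A] [Algebra k A] {𝒜 : ComoduleAlgebra 𝓗 A}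

namespace ComoduleAlgebra.Cleaving

variable (𝒞 : 𝒜.Cleaving) (X : HopfModule 𝒜)

theorem j_mul_η (r : R) (h : H) : 𝒞.j (𝓗.rR (op r) h) = 𝒞.j h * 𝒜.η r :=
  (𝒞.j_hom.actR (op r) h).trans (𝒜.actR_eq r _)

/-- The map `m ↦ m⁰ j'(m¹)`, which projects a Hopf module onto its coinvariants. -/
def proj : X.carrier →ₗ[k] X.carrier :=
  convolution X.com.coR (Φ := LinearMap.id) X.actR_eq 𝒞.j'_left

theorem proj_actL (l : L) (m : X.carrier) :
    𝒞.proj X (X.com.actL (op l) m) = X.act (op (𝒞.ηL l)) (𝒞.proj X m) :=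
  X.com.coassocRL.convolution_right_linear (Φ := LinearMap.id) X.actR_eq 𝒞.j'_left 𝒞.j'_right l m

theorem convolution_proj_j (m : X.carrier) :
    convolution X.com.coL (𝒞.proj_actL X) 𝒞.j_left m = m :=
  X.com.coassocRL.convolution_cancel (Φ := LinearMap.id) X.actR_eq 𝒞.j'_left 𝒞.j'_right 𝒞.j_left
    X.com.isComoduleR.counit 𝒞.j'_mul_j m

theorem coR_proj_actL (l : L) (m : X.carrier) :
    (X.com.coR ∘ₗ 𝒞.proj X) (X.com.actL (op l) m) =
      X.diagAct (op (𝒞.ηL l)) ((X.com.coR ∘ₗ 𝒞.proj X) m) := by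
  simp only [LinearMap.comp_apply, proj_actL, X.coR_act, X.diagAct_op]

theorem convolution_coR_proj_j (m : X.carrier) :
    convolution X.com.coL (𝒞.coR_proj_actL X) 𝒞.j_left m = X.com.coR m := by
  rw [← map_convolution (𝒞.proj_actL X) 𝒞.j_left (fun a m => X.coR_act a m) X.com.coL m,
    convolution_proj_j]

theorem mk_proj_one_actL (l : L) (m : X.carrier) :
    ((BT.mk X.com.actR 𝓗.lR).flip 1 ∘ₗ 𝒞.proj X) (X.com.actL (op l) m) =
      X.diagAct (op (𝒞.ηL l)) (((BT.mk X.com.actR 𝓗.lR).flip 1 ∘ₗ 𝒞.proj X) m) := by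
  have coR_ηL : 𝒜.com.coR (𝒞.ηL l) = BT.mk _ _ (𝒞.ηL l) 1 := 𝒞.ηL_mem l
  simp only [LinearMap.comp_apply, LinearMap.flip_apply, proj_actL, X.diagAct_op, X.diag_mk]
  rw [coR_ηL, X.orbitMap_mk, mul_one]

theorem convolution_mk_proj_one_j (m : X.carrier) :
    convolution X.com.coL (𝒞.mk_proj_one_actL X) 𝒞.j_left m = X.com.coR m := by
  have act_j_actR (m : X.carrier) (r : Rᵐᵒᵖ) (h : H) :
      X.act.bil.compl₁₂ (𝒞.proj X) 𝒞.j m (𝓗.rR r h) =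
        X.com.actR r (X.act.bil.compl₁₂ (𝒞.proj X) 𝒞.j m h) := by
    simp only [LinearMap.compl₁₂_apply, ← X.isAction.actR]
    exact congrArg _ (𝒞.j_hom.actR r h)
  let G : X.carrier →ₗ[k] BT 𝓗.rR 𝓗.lR →ₗ[k] BT X.com.actR 𝓗.lR :=
    (BT.mapL (X.act.bil.compl₁₂ (𝒞.proj X) 𝒞.j) act_j_actR).flip
  have G_mk (m : X.carrier) (x y : H) : G m (BT.mk 𝓗.rR 𝓗.lR x y) =
      BT.mk X.com.actR 𝓗.lR (X.act (op (𝒞.j x)) (𝒞.proj X m)) y := by simp [G]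
  have orbitMap_coR_j (m : X.carrier) (h : H) :
      X.orbitMap (𝒞.proj X m) 1 (𝒜.com.coR (𝒞.j h)) = G m (𝓗.right.Δ h) := by
    rw [𝒞.j_hom.coR]
    exact LinearMap.congr_fun
      (f := X.orbitMap (𝒞.proj X m) 1 ∘ₗ BT.map 𝒞.j LinearMap.id 𝒞.j_hom.actR (fun _ _ => rfl))
      (g := G m) (BT.hom_ext fun x y => by
        rw [LinearMap.comp_apply, BT.map_mk, X.orbitMap_mk, one_mul]
        exact (G_mk m x y).symm) (𝓗.right.Δ h)
  exact (X.com.coassocLR.lift_eq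
    (F := BT.mk X.com.actR 𝓗.lR ∘ₗ BT.liftAct X.act (𝒞.proj_actL X) 𝒞.j_left)
    (G := G)
    (fun m h x => (congrArg (fun n => BT.mk X.com.actR 𝓗.lR n x)
      (BT.liftAct_mk (𝒞.proj_actL X) 𝒞.j_left m h)).trans (G_mk m h x).symm) (f := LinearMap.id)
    (fun m x => congrArg (fun n => BT.mk X.com.actR 𝓗.lR n x) (𝒞.convolution_proj_j X m).symm)
    (g := BT.liftAct X.diagAct (𝒞.mk_proj_one_actL X) 𝒞.j_left)
    (fun m h => (BT.liftAct_mk (𝒞.mk_proj_one_actL X) 𝒞.j_left m h).trans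
      ((X.diag_mk _ _ 1).trans (orbitMap_coR_j m h))) m).symm

theorem coR_comp_proj : X.com.coR ∘ₗ 𝒞.proj X = (BT.mk X.com.actR 𝓗.lR).flip 1 ∘ₗ 𝒞.proj X :=
  X.com.coassocLR.convolution_right_injective (𝒞.coR_proj_actL X) (𝒞.mk_proj_one_actL X) 𝒞.j_left
    𝒞.j_mul_η 𝒞.j'_left X.com.isComoduleL.counit 𝒞.j_mul_j'
    (fun m => (𝒞.convolution_coR_proj_j X m).trans (𝒞.convolution_mk_proj_one_j X m).symm)

theorem proj_mem_coinv (m : X.carrier) : 𝒞.proj X m ∈ X.com.coinv :=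
  LinearMap.congr_fun (𝒞.coR_comp_proj X) m

variable {X} {Y : HopfModule 𝒜}

theorem proj_hom {f : X.carrier →ₗ[k] Y.carrier} (hf : X.com.IsHom Y.com f)
    (hact : ∀ a m, f (X.act (op a) m) = Y.act (op a) (f m)) (m : X.carrier) :
    𝒞.proj Y (f m) = f (𝒞.proj X m) :=
  (convolution_comp (Φ := LinearMap.id) Y.actR_eq 𝒞.j'_left hf.coR m).trans
    (map_convolution (Φ := LinearMap.id) X.actR_eq 𝒞.j'_left hact X.com.coR m).symm

theorem proj_act_of_mem_coinv {n : X.carrier} (hn : n ∈ X.com.coinv) (a : A) :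
    𝒞.proj X (X.act (op a) n) = X.act (op (𝒞.proj 𝒜.self a)) n :=
  𝒞.proj_hom (X := 𝒜.self) (HopfModule.isHom_of_mem_coinv hn) (fun b c => by simp) a

theorem proj_of_mem_coinv {n : X.carrier} (hn : n ∈ X.com.coinv) :
    𝒞.proj X n = X.act (op (𝒞.j' 1)) n :=
  (congrArg (BT.liftAct X.act (Φ := LinearMap.id) X.actR_eq 𝒞.j'_left) hn).trans
    (BT.liftAct_mk (Φ := LinearMap.id) X.actR_eq 𝒞.j'_left n 1)

theorem j_one_mem_coinvariants : 𝒞.j 1 ∈ 𝒜.coinvariants :=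
  𝒞.j_hom.map_mem_coinv 𝓗.right.Δ_one

theorem j'_one_mul_j_one : 𝒞.j' 1 * 𝒞.j 1 = 1 := by
  simpa [𝓗.left.Δ_one, 𝓗.right.ε_one, BT.lift_mk] using 𝒞.j'_mul_j 1

end ComoduleAlgebra.Cleaving

end Projection

section Induction

variable {k : Type u₁} [CommRing k] {L : Type u₂} [Ring L] [Algebra k L] {R : Type u₃} [Ring R]
  [Algebra k R] {H : Type u₄} [Ring H] [Algebra k H] {𝓗 : HopfAlgebroid k L R H}
  {A : Type u₅} [Ring A] [Algebra k A] {𝒜 : ComoduleAlgebra 𝓗 A}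
  {B : Type*} [Ring B] [Algebra k B] {f : B →ₐ[k] A}
  {W : Type*} [AddCommGroup W] [Module k W] {ρ : RAct k B W}

section BalancedTensor

variable {M M' M'' N : Type*} [AddCommGroup M] [Module k M] [AddCommGroup M'] [Module k M']
  [AddCommGroup M''] [Module k M''] [AddCommGroup N] [Module k N]
  {σ : RAct k B M} {σ' : RAct k B M'} {σ'' : RAct k B M''} {τ : LAct k B N}

theorem BT.map_map {g : M' →ₗ[k] M''} {f : M →ₗ[k] M'}
    (hg : ∀ (b : Bᵐᵒᵖ) m, g (σ' b m) = σ'' b (g m)) (hf : ∀ (b : Bᵐᵒᵖ) m, f (σ b m) = σ' b (f m))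
    (z : BT σ τ) :
    BT.map g LinearMap.id hg (fun _ _ => rfl) (BT.map f LinearMap.id hf (fun _ _ => rfl) z) =
      BT.map (σ' := τ) (g ∘ₗ f) LinearMap.id (fun b m => by simp [hf, hg]) (fun _ _ => rfl) z :=
  LinearMap.congr_fun
    (f := BT.map g LinearMap.id hg (fun _ _ => rfl) ∘ₗ BT.map f LinearMap.id hf (fun _ _ => rfl))
    (g := BT.map (σ' := τ) (g ∘ₗ f) LinearMap.id (fun b m => by simp [hf, hg]) (fun _ _ => rfl))
    (BT.hom_ext fun m n => by simp) z

theorem BT.map_symm_map {e : M ≃ₗ[k] M'}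
    (he : ∀ (b : Bᵐᵒᵖ) m, e.toLinearMap (σ b m) = σ' b (e.toLinearMap m))
    (he' : ∀ (b : Bᵐᵒᵖ) m, e.symm.toLinearMap (σ' b m) = σ b (e.symm.toLinearMap m))
    (z : BT σ τ) :
    BT.map e.symm.toLinearMap LinearMap.id he' (fun _ _ => rfl)
      (BT.map e.toLinearMap LinearMap.id he (fun _ _ => rfl) z) = z :=
  LinearMap.congr_fun
    (f := BT.map e.symm.toLinearMap LinearMap.id he' (fun _ _ => rfl) ∘ₗ
      BT.map e.toLinearMap LinearMap.id he (fun _ _ => rfl)) (g := LinearMap.id)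
    (BT.hom_ext fun m n => by simp) z

end BalancedTensor

namespace HComodule

variable {M M' : Type*} [AddCommGroup M] [Module k M] [AddCommGroup M'] [Module k M']

theorem IsHom.symm {X : HComodule 𝓗 M} {X' : HComodule 𝓗 M'} {e : M ≃ₗ[k] M'}
    (h : X.IsHom X' e.toLinearMap) : X'.IsHom X e.symm.toLinearMap where
  actR r m := by simpa [e.symm_apply_eq] using (h.actR r (e.symm m)).symm
  actL l m := by simpa [e.symm_apply_eq] using (h.actL l (e.symm m)).symm
  coR m := by
    obtain ⟨m, rfl⟩ := e.surjective m
    exact (congrArg X.coR (e.symm_apply_apply m)).trans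
      ((congrArg _ (h.coR m)).trans (BT.map_symm_map h.actR _ (X.coR m))).symm
  coL m := by
    obtain ⟨m, rfl⟩ := e.surjective m
    exact (congrArg X.coL (e.symm_apply_apply m)).trans
      ((congrArg _ (h.coL m)).trans (BT.map_symm_map h.actL _ (X.coL m))).symm

end HComodule

namespace ComoduleAlgebra

/-- The Hopf module `W ⊗_B A` induced by a right `B`-module `W`. -/
abbrev induced (𝒜 : ComoduleAlgebra 𝓗 A) (f : B →ₐ[k] A) (hf : ∀ b, f b ∈ 𝒜.coinvariants)
    (ρ : RAct k B W) : HopfModule 𝒜 where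
  carrier := BT ρ (lmulL f)
  com := 𝒜.inducedComodule f hf ρ
  act := inducedAct f ρ
  isAction := 𝒜.induced_isAction f hf ρ

section Induced

variable (hf : ∀ b, f b ∈ 𝒜.coinvariants) {X : HopfModule 𝒜}

theorem induced_isHom {g : BT ρ (lmulL f) →ₗ[k] X.carrier}
    (hg : ∀ w, 𝒜.com.IsHom X.com (g ∘ₗ BT.mk ρ (lmulL f) w)) :
    (𝒜.induced f hf ρ).com.IsHom X.com g where
  actR r z := LinearMap.congr_fun (f := g ∘ₗ 𝒜.indActR f hf ρ r) (g := X.com.actR r ∘ₗ g)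
    (BT.hom_ext fun w a => by
      simpa [indActR_mk] using (hg w).actR r a) z
  actL l z := LinearMap.congr_fun (f := g ∘ₗ 𝒜.indActL f hf ρ l) (g := X.com.actL l ∘ₗ g)
    (BT.hom_ext fun w a => by
      simpa [indActL_mk] using (hg w).actL l a) z
  coR z := by
    induction z using BT.induction with
    | hm w a =>
      exact ((hg w).coR a).trans ((congrArg _ ((𝒜.mk_isHom f hf ρ w).coR a)).trans
        (BT.map_map _ _ _)).symm
    | h0 => simp
    | ha x y hx hy => simp only [map_add, hx, hy]
  coL z := by
    induction z using BT.induction with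
    | hm w a =>
      exact ((hg w).coL a).trans ((congrArg _ ((𝒜.mk_isHom f hf ρ w).coL a)).trans
        (BT.map_map _ _ _)).symm
    | h0 => simp
    | ha x y hx hy => simp only [map_add, hx, hy]

theorem mk_one_mem_coinv (w : W) : BT.mk ρ (lmulL f) w 1 ∈ (𝒜.induced f hf ρ).com.coinv :=
  (𝒜.mk_isHom f hf ρ w).map_mem_coinv 𝒜.coR_one

end Induced

variable {X : HopfModule 𝒜} {i : W →ₗ[k] X.carrier}
  (hi : ∀ b w, i (ρ (op b) w) = X.act (op (f b)) (i w))

/-- The `A`-linear extension `w ⊗ a ↦ i(w) a` of a right `B`-linear map `i : W → X`. -/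
def extend : BT ρ (lmulL f) →ₗ[k] X.carrier :=
  BT.lift (X.act.bil ∘ₗ i) (fun b w a => by simp [hi])

@[simp] theorem extend_mk (w : W) (a : A) :
    extend hi (BT.mk ρ (lmulL f) w a) = X.act (op a) (i w) :=
  BT.lift_mk _ _ w a

theorem extend_act (a : A) (z : BT ρ (lmulL f)) :
    extend hi (inducedAct f ρ (op a) z) = X.act (op a) (extend hi z) :=
  LinearMap.congr_fun (f := extend hi ∘ₗ inducedAct f ρ (op a)) (g := X.act (op a) ∘ₗ extend hi)
    (BT.hom_ext fun w b => by simp [inducedAct_mk]) z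

theorem extend_isHom (hf : ∀ b, f b ∈ 𝒜.coinvariants) (hcoinv : ∀ w, i w ∈ X.com.coinv) :
    (𝒜.induced f hf ρ).com.IsHom X.com (extend hi) :=
  induced_isHom hf fun w => by
    have h : extend hi ∘ₗ BT.mk ρ (lmulL f) w = X.act.bil (i w) :=
      LinearMap.ext fun a => by simp
    exact h ▸ HopfModule.isHom_of_mem_coinv (hcoinv w)

end ComoduleAlgebra

end Induction

section Bijectivity

variable {k : Type u₁} [CommRing k] {L : Type u₂} [Ring L] [Algebra k L] {R : Type u₃} [Ring R]
  [Algebra k R] {H : Type u₄} [Ring H] [Algebra k H] {𝓗 : HopfAlgebroid k L R H}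
  {A : Type u₅} [Ring A] [Algebra k A] {𝒜 : ComoduleAlgebra 𝓗 A}
  {B : Type*} [Ring B] [Algebra k B] {f : B →ₐ[k] A}
  {W : Type*} [AddCommGroup W] [Module k W] {ρ : RAct k B W}

namespace ComoduleAlgebra.Cleaving

variable (𝒞 : 𝒜.Cleaving)

theorem proj_mk (hf : ∀ b, f b ∈ 𝒜.coinvariants) (w : W) (a : A) :
    𝒞.proj (𝒜.induced f hf ρ) (BT.mk ρ (lmulL f) w a) =
      BT.mk ρ (lmulL f) w (𝒞.proj 𝒜.self a) :=
  𝒞.proj_hom (X := 𝒜.self) (Y := 𝒜.induced f hf ρ) (𝒜.mk_isHom f hf ρ w)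
    (fun a b => (inducedAct_mk f ρ w b a).symm) a

section Unit

variable (hinj : Function.Injective f) (hsurj : ∀ a ∈ 𝒜.coinvariants, ∃ b, f b = a)

/-- The retraction `a ↦ a⁰ j'(a¹) j(1)` of an embedding `f : B → A` onto the coinvariants. -/
noncomputable def retraction : A →ₗ[k] B :=
  LinearMap.codRestrictOfInjective (LinearMap.mulRight k (𝒞.j 1) ∘ₗ 𝒞.proj 𝒜.self) f.toLinearMap
    hinj fun a => hsurj _ (mul_mem (𝒞.proj_mem_coinv 𝒜.self a) 𝒞.j_one_mem_coinvariants)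

theorem map_retraction (a : A) : f (𝒞.retraction hinj hsurj a) = 𝒞.proj 𝒜.self a * 𝒞.j 1 :=
  LinearMap.codRestrictOfInjective_comp_apply _ f.toLinearMap hinj _ a

theorem retraction_one : 𝒞.retraction hinj hsurj 1 = 1 := hinj <| by
  rw [map_retraction, 𝒞.proj_of_mem_coinv (X := 𝒜.self) 𝒜.coR_one]
  simp [𝒞.j'_one_mul_j_one]

theorem retraction_lmulL (hf : ∀ b, f b ∈ 𝒜.coinvariants) (b : B) (a : A) :
    𝒞.retraction hinj hsurj (lmulL f b a) = b * 𝒞.retraction hinj hsurj a := hinj <| by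
  have proj_mul : 𝒞.proj 𝒜.self (f b * a) = f b * 𝒞.proj 𝒜.self a :=
    𝒞.proj_act_of_mem_coinv (X := 𝒜.self) (hf b) a
  rw [map_mul, map_retraction, map_retraction, lmulL_apply, proj_mul, mul_assoc]

include 𝒞 hinj hsurj in
theorem mk_one_injective (hf : ∀ b, f b ∈ 𝒜.coinvariants) :
    Function.Injective fun w => BT.mk ρ (lmulL f) w 1 :=
  Function.LeftInverse.injective
    (g := BT.contr ρ (lmulL f) (𝒞.retraction hinj hsurj) (𝒞.retraction_lmulL hinj hsurj hf))
    fun w => by simp [𝒞.retraction_one hinj hsurj]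

theorem mk_contr_retraction_one (hf : ∀ b, f b ∈ 𝒜.coinvariants) (z : BT ρ (lmulL f)) :
    BT.mk ρ (lmulL f) (BT.contr ρ (lmulL f) (𝒞.retraction hinj hsurj)
      (𝒞.retraction_lmulL hinj hsurj hf) z) 1 =
      inducedAct f ρ (op (𝒞.j 1)) (𝒞.proj (𝒜.induced f hf ρ) z) :=
  LinearMap.congr_fun
    (f := (BT.mk ρ (lmulL f)).flip 1 ∘ₗ BT.contr ρ (lmulL f) (𝒞.retraction hinj hsurj)
      (𝒞.retraction_lmulL hinj hsurj hf))
    (g := inducedAct f ρ (op (𝒞.j 1)) ∘ₗ 𝒞.proj (𝒜.induced f hf ρ))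
    (BT.hom_ext fun w a => by
      refine Eq.trans ?_ ((congrArg _ (𝒞.proj_mk hf w a)).trans (inducedAct_mk f ρ w _ _)).symm
      simp [BT.mk_bal, map_retraction]) z

include 𝒞 hinj hsurj in
theorem exists_mk_one_eq (hf : ∀ b, f b ∈ 𝒜.coinvariants) {z : BT ρ (lmulL f)}
    (hz : z ∈ (𝒜.induced f hf ρ).com.coinv) : ∃ w, BT.mk ρ (lmulL f) w 1 = z := by
  refine ⟨_, (𝒞.mk_contr_retraction_one hinj hsurj hf z).trans ?_⟩
  rw [𝒞.proj_of_mem_coinv hz, ← Module.End.mul_apply, ← map_mul, ← op_mul,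
    j'_one_mul_j_one, op_one, map_one, Module.End.one_apply]

end Unit

section Counit

variable {X : HopfModule 𝒜} {i : W →ₗ[k] X.carrier}
  (hi : ∀ b w, i (ρ (op b) w) = X.act (op (f b)) (i w))
  (hi_inj : Function.Injective i) (hi_surj : ∀ m ∈ X.com.coinv, ∃ w, i w = m)

/-- The projection `m ↦ m⁰ j'(m¹)`, with values in a module `W` that `i` identifies with the
coinvariants. -/
noncomputable def projTo : X.carrier →ₗ[k] W :=
  LinearMap.codRestrictOfInjective (𝒞.proj X) i hi_inj fun m => hi_surj _ (𝒞.proj_mem_coinv X m)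

theorem map_projTo (m : X.carrier) : i (𝒞.projTo hi_inj hi_surj m) = 𝒞.proj X m :=
  LinearMap.codRestrictOfInjective_comp_apply _ i hi_inj _ m

include hi in
theorem mk_projTo_one_actL (hf_surj : ∀ a ∈ 𝒜.coinvariants, ∃ b, f b = a) (l : L) (m : X.carrier) :
    ((BT.mk ρ (lmulL f)).flip 1 ∘ₗ 𝒞.projTo hi_inj hi_surj) (X.com.actL (op l) m) =
      inducedAct f ρ (op (𝒞.ηL l))
        (((BT.mk ρ (lmulL f)).flip 1 ∘ₗ 𝒞.projTo hi_inj hi_surj) m) := by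
  obtain ⟨b, hb⟩ := hf_surj _ (𝒞.ηL_mem l)
  have projTo_actL : 𝒞.projTo hi_inj hi_surj (X.com.actL (op l) m) =
      ρ (op b) (𝒞.projTo hi_inj hi_surj m) :=
    hi_inj <| by rw [map_projTo, hi, map_projTo, proj_actL, hb]
  simp [projTo_actL, inducedAct_mk, BT.mk_bal, hb]

theorem mk_projTo_extend_one (hf : ∀ b, f b ∈ 𝒜.coinvariants)
    (hf_surj : ∀ a ∈ 𝒜.coinvariants, ∃ b, f b = a) (hi_mem : ∀ w, i w ∈ X.com.coinv)
    (z : BT ρ (lmulL f)) :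
    BT.mk ρ (lmulL f) (𝒞.projTo hi_inj hi_surj (extend hi z)) 1 = 𝒞.proj (𝒜.induced f hf ρ) z :=
  LinearMap.congr_fun
    (f := (BT.mk ρ (lmulL f)).flip 1 ∘ₗ 𝒞.projTo hi_inj hi_surj ∘ₗ extend hi)
    (g := 𝒞.proj (𝒜.induced f hf ρ))
    (BT.hom_ext fun w a => by
      obtain ⟨b, hb⟩ := hf_surj _ (𝒞.proj_mem_coinv 𝒜.self a)
      have projTo_act : 𝒞.projTo hi_inj hi_surj (X.act (op a) (i w)) = ρ (op b) w :=
        hi_inj <| by rw [map_projTo, hi, hb, 𝒞.proj_act_of_mem_coinv (hi_mem w)]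
      refine Eq.trans ?_ (𝒞.proj_mk hf w a).symm
      simp [projTo_act, BT.mk_bal, hb]) z

include 𝒞 hi_inj hi_surj in
theorem extend_bijective (hf : ∀ b, f b ∈ 𝒜.coinvariants)
    (hf_surj : ∀ a ∈ 𝒜.coinvariants, ∃ b, f b = a) (hi_mem : ∀ w, i w ∈ X.com.coinv) :
    Function.Bijective (extend hi) := by
  have hΦ := 𝒞.mk_projTo_one_actL hi hi_inj hi_surj hf_surj
  refine Function.bijective_iff_has_inverse.2
    ⟨convolution X.com.coL hΦ 𝒞.j_left, fun z => ?_, fun m => ?_⟩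
  · exact (convolution_comp hΦ 𝒞.j_left (extend_isHom hi hf hi_mem).coL z).trans <|
      (convolution_congr _ 𝒞.j_left (𝒞.proj_actL (𝒜.induced f hf ρ)) _
        (𝒞.mk_projTo_extend_one hi hi_inj hi_surj hf hf_surj hi_mem) z).trans <|
      𝒞.convolution_proj_j (𝒜.induced f hf ρ) z
  · exact (map_convolution hΦ 𝒞.j_left (extend_act hi) X.com.coL m).trans <|
      (convolution_congr _ 𝒞.j_left (𝒞.proj_actL X) _ (fun m => by simp [map_projTo]) m).trans <|
      𝒞.convolution_proj_j X m

end Counit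

end ComoduleAlgebra.Cleaving

end Bijectivity

section Adjunction

variable {k : Type u₁} [CommRing k] {L : Type u₂} [Ring L] [Algebra k L] {R : Type u₃} [Ring R]
  [Algebra k R] {H : Type u₄} [Ring H] [Algebra k H] {𝓗 : HopfAlgebroid k L R H}
  {A : Type u₅} [Ring A] [Algebra k A] {𝒜 : ComoduleAlgebra 𝓗 A}
  {B : Type*} [Ring B] [Algebra k B] {f : B →ₐ[k] A} (hf : ∀ b, f b ∈ 𝒜.coinvariants)

attribute [local instance] ComoduleAlgebra.moduleCatModule

theorem HopfModule.isIso_of_bijective {X Y : HopfModule.{v} 𝒜} (φ : X ⟶ Y)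
    (hφ : Function.Bijective φ.map) : IsIso φ := by
  let e := LinearEquiv.ofBijective φ.map hφ
  refine ⟨⟨e.symm.toLinearMap, fun a m => ?_, HComodule.IsHom.symm (e := e) φ.isHom⟩,
    HopfModule.hom_ext e.symm_apply_apply, HopfModule.hom_ext e.apply_symm_apply⟩
  exact e.symm_apply_eq.2 ((φ.map_act a (e.symm m)).trans
    (congrArg (Y.act a) (e.apply_symm_apply m))).symm

namespace ComoduleAlgebra

/-- The coinvariants of a Hopf module, as a right `B`-module. -/
def coinvModuleCat (X : HopfModule.{v} 𝒜) : ModuleCat.{v} Bᵐᵒᵖ :=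
  letI := Module.compHom X.carrier (X.act.comp (AlgHom.op f)).toRingHom
  ModuleCat.of Bᵐᵒᵖ (show Submodule Bᵐᵒᵖ X.carrier from
    { X.com.coinv.toAddSubmonoid with
      smul_mem' := fun b _ hn => HopfModule.act_mem_coinv hn (hf b.unop) })

/-- The inclusion of the coinvariants into a Hopf module. -/
def coinvIncl (X : HopfModule.{v} 𝒜) : coinvModuleCat hf X →ₗ[k] X.carrier where
  toFun := Subtype.val (p := (· ∈ X.com.coinv))
  map_add' _ _ := rfl
  map_smul' c n := by
    change X.act (op (f (algebraMap k B c))) _ = _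
    rw [AlgHom.commutes, ← MulOpposite.algebraMap_apply, AlgHom.commutes]
    rfl

section

variable (X : HopfModule.{v} 𝒜)

theorem coinvIncl_mem (n : coinvModuleCat hf X) : coinvIncl hf X n ∈ X.com.coinv :=
  Subtype.property (p := (· ∈ X.com.coinv)) n

theorem coinvIncl_modAct (b : B) (n : coinvModuleCat hf X) :
    coinvIncl hf X (modAct (k := k) _ (op b) n) = X.act (op (f b)) (coinvIncl hf X n) :=
  (rfl)

theorem coinvIncl_injective : Function.Injective (coinvIncl hf X) :=
  Subtype.val_injective (p := (· ∈ X.com.coinv))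

theorem exists_coinvIncl_eq {m : X.carrier} (hm : m ∈ X.com.coinv) : ∃ n, coinvIncl hf X n = m :=
  ⟨(⟨m, hm⟩ : X.com.coinv), rfl⟩

end

section

variable {X : HopfModule.{v} 𝒜} {W : ModuleCat.{v} Bᵐᵒᵖ} {g : W →ₗ[k] X.carrier}
  (hg : ∀ b w, g (modAct (k := k) W (op b) w) = X.act (op (f b)) (g w))
  (hmem : ∀ w, g w ∈ X.com.coinv)

/-- The factorization through the coinvariants of a `B`-linear map with coinvariant values. -/
def coinvLift : W ⟶ coinvModuleCat hf X :=
  ModuleCat.ofHom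
    { toFun := fun w => (⟨g w, hmem w⟩ : X.com.coinv)
      map_add' := fun w w' => coinvIncl_injective hf X (map_add g w w')
      map_smul' := fun b w => coinvIncl_injective hf X (hg b.unop w) }

theorem coinvModuleCat_hom_ext {g g' : W ⟶ coinvModuleCat hf X}
    (h : ∀ w, coinvIncl hf X (g w) = coinvIncl hf X (g' w)) : g = g' :=
  ModuleCat.hom_ext <| LinearMap.ext fun w => coinvIncl_injective hf X (h w)

end

section Transpose

variable {W : ModuleCat.{max v u₅} Bᵐᵒᵖ} {X : HopfModule.{max v u₅} 𝒜}

/-- The right `B`-linear map `w ↦ φ(w ⊗ 1)` to the coinvariants, for a map `φ : W ⊗_B A → X` of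
Hopf modules. -/
def restrictHom (φ : (𝒜.inducedFunctor.{v} f hf).obj W ⟶ X) : W ⟶ coinvModuleCat hf X :=
  coinvLift hf (g := φ.map ∘ₗ (BT.mk (modAct W) (lmulL f)).flip 1)
    (fun b w => by
      have mk_act_one : BT.mk (modAct (k := k) W) (lmulL f) (modAct (k := k) W (op b) w) 1 =
          inducedAct f (modAct W) (op (f b)) (BT.mk _ _ w 1) := by
        rw [BT.mk_bal, inducedAct_mk, lmulL_apply, mul_one, one_mul]
      exact (congrArg φ.map mk_act_one).trans (φ.map_act (op (f b)) _))
    (fun w => φ.isHom.map_mem_coinv (mk_one_mem_coinv hf w))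

theorem coinvIncl_modMap_modAct (g : W ⟶ coinvModuleCat hf X) (b : B) (w : W) :
    (coinvIncl hf X ∘ₗ modMap g) (modAct (k := k) W (op b) w) =
      X.act (op (f b)) ((coinvIncl hf X ∘ₗ modMap g) w) := by
  rw [LinearMap.comp_apply, modMap_act, coinvIncl_modAct, LinearMap.comp_apply]

/-- The map `w ⊗ a ↦ g(w) a` of Hopf modules, for a right `B`-linear map `g` from `W` to the
coinvariants of `X`. -/
def extendHom (g : W ⟶ coinvModuleCat hf X) : (𝒜.inducedFunctor.{v} f hf).obj W ⟶ X where
  map := extend (i := coinvIncl hf X ∘ₗ modMap g) (coinvIncl_modMap_modAct hf g)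
  map_act a := extend_act _ a.unop
  isHom := extend_isHom _ hf fun w => coinvIncl_mem hf X (g w)

theorem extendHom_map_mk (g : W ⟶ coinvModuleCat hf X) (w : W) (a : A) :
    (extendHom hf g).map (BT.mk (modAct (k := k) W) (lmulL f) w a) =
      X.act (op a) (coinvIncl hf X (g w)) :=
  extend_mk (coinvIncl_modMap_modAct hf g) w a

theorem extendHom_restrictHom (φ : (𝒜.inducedFunctor.{v} f hf).obj W ⟶ X) :
    extendHom hf (restrictHom hf φ) = φ :=
  HopfModule.Hom.ext <| BT.hom_ext fun w a => by
    have mk_eq : BT.mk (modAct (k := k) W) (lmulL f) w a =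
        inducedAct f (modAct W) (op a) (BT.mk _ _ w 1) := by rw [inducedAct_mk, one_mul]
    exact (extendHom_map_mk hf _ w a).trans
      ((φ.map_act (op a) _).symm.trans (congrArg φ.map mk_eq).symm)

theorem restrictHom_extendHom (g : W ⟶ coinvModuleCat hf X) :
    restrictHom hf (extendHom hf g) = g :=
  coinvModuleCat_hom_ext hf fun w => (extendHom_map_mk.{v} hf g w 1).trans (by simp)

theorem extendHom_comp {W' : ModuleCat.{max v u₅} Bᵐᵒᵖ} (g : W' ⟶ W)
    (g' : W ⟶ coinvModuleCat hf X) :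
    extendHom hf (g ≫ g') = (𝒜.inducedFunctor.{v} f hf).map g ≫ extendHom hf g' :=
  HopfModule.Hom.ext <| BT.hom_ext fun w a =>
    (extendHom_map_mk hf (g ≫ g') w a).trans
      ((congrArg _ (indMap_mk f g w a)).trans (extendHom_map_mk hf g' _ a)).symm

end Transpose

variable (f)

/-- The functor that sends a Hopf module to the right `B`-module of its coinvariants. -/
def coinvFunctor : HopfModule.{v} 𝒜 ⥤ ModuleCat.{v} Bᵐᵒᵖ where
  obj X := coinvModuleCat hf X
  map {X Y} φ := coinvLift hf (X := Y) (g := φ.map ∘ₗ coinvIncl hf X)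
    (fun b n => φ.map_act (op (f b)) (coinvIncl hf X n))
    (fun n => φ.isHom.map_mem_coinv (coinvIncl_mem hf X n))

/-- The adjunction between induction and coinvariants. -/
def inducedAdjunction : 𝒜.inducedFunctor.{v} f hf ⊣ coinvFunctor.{max v u₅} f hf :=
  Adjunction.mkOfHomEquiv
    { homEquiv := fun _ _ =>
        ⟨restrictHom hf, extendHom hf, extendHom_restrictHom hf, restrictHom_extendHom hf⟩
      homEquiv_naturality_left_symm := extendHom_comp hf
      homEquiv_naturality_right := fun _ _ => rfl }

theorem Cleaving.isEquivalence_inducedFunctor (𝒞 : 𝒜.Cleaving) (hinj : Function.Injective f)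
    (hsurj : ∀ a ∈ 𝒜.coinvariants, ∃ b, f b = a) : (𝒜.inducedFunctor.{v} f hf).IsEquivalence := by
  let adj := inducedAdjunction.{v} f hf
  have isIso_unit (W : ModuleCat.{max v u₅} Bᵐᵒᵖ) : IsIso (adj.unit.app W) := by
    refine (ConcreteCategory.isIso_iff_bijective _).2 ⟨fun w w' h => ?_, fun n => ?_⟩
    · exact 𝒞.mk_one_injective hinj hsurj (ρ := modAct W) hf (congrArg (coinvIncl hf _) h)
    · obtain ⟨w, hw⟩ := 𝒞.exists_mk_one_eq hinj hsurj (ρ := modAct W) hf (coinvIncl_mem hf _ n)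
      exact ⟨w, coinvIncl_injective hf _ hw⟩
  have isIso_counit (X : HopfModule.{max v u₅} 𝒜) : IsIso (adj.counit.app X) :=
    HopfModule.isIso_of_bijective _ <| 𝒞.extend_bijective (coinvIncl_modAct hf X)
      (coinvIncl_injective hf X) (fun _ => exists_coinvIncl_eq hf X) hf hsurj (coinvIncl_mem hf X)
  exact adj.toEquivalence.isEquivalence_functor

end ComoduleAlgebra

end Adjunction

section Regular

variable {k : Type*} [CommRing k] {L : Type*} [Ring L] [Algebra k L] {R : Type*} [Ring R]
  [Algebra k R] {H : Type*} [Ring H] [Algebra k H] (𝓗 : HopfAlgebroid k L R H)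

namespace HopfAlgebroid

/-- The cleaving of the regular comodule algebra given by the antipode. -/
def regularCleaving : 𝓗.regular.Cleaving where
  ηL := 𝓗.left.s
  ηL_mem := 𝓗.s_left_mem
  j := LinearMap.id
  j_left _ _ := rfl
  j_hom := .id _
  j' := 𝓗.S
  j'_left r h := by
    change _ = 𝓗.right.s r * _
    simpa using 𝓗.S_twist 1 r h
  j'_right l h := by simpa using 𝓗.S_twist l 1 h
  j_mul_j' := 𝓗.antipode_right
  j'_mul_j := 𝓗.antipode_left

theorem exists_left_s_eq {a : H} (ha : a ∈ 𝓗.regular.coinvariants) : ∃ l, 𝓗.left.s l = a := by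
  have Δ_eq : 𝓗.right.Δ a = BT.mk _ _ a 1 := ha
  refine ⟨𝓗.left.ε a, ?_⟩
  rw [← 𝓗.antipode_right, Δ_eq, BT.lift_mk]
  simp [𝓗.S_one]

end HopfAlgebroid

end Regular

end HopfAlgd

theorem mainTheorem6 {k : Type u₁} [CommRing k] {L : Type u₂} [Ring L] [Algebra k L]
    {R : Type u₃} [Ring R] [Algebra k R] {H : Type u₄} [Ring H] [Algebra k H]
    (𝓗 : HopfAlgd.HopfAlgebroid k L R H) :
    (∀ {A : Type u₅} [Ring A] [Algebra k A] (𝒜 : HopfAlgd.ComoduleAlgebra 𝓗 A), 𝒜.IsCleft →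
      (HopfAlgd.ComoduleAlgebra.tensorFunctor.{v} 𝒜).IsEquivalence) ∧
    (HopfAlgd.HopfAlgebroid.tensorFunctor.{v} 𝓗).IsEquivalence := by
  refine ⟨fun 𝒜 ⟨𝒞⟩ => ?_, ?_⟩
  · exact 𝒞.isEquivalence_inducedFunctor _ _ Subtype.val_injective fun a ha => ⟨⟨a, ha⟩, rfl⟩
  · exact 𝓗.regularCleaving.isEquivalence_inducedFunctor _ _
      (Function.LeftInverse.injective 𝓗.ε_s_left) fun _ ha => 𝓗.exists_left_s_eq ha
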